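/- **Theorem 3.3.** Let $N\ge 1$ and let $B_R(x)$ denote the open ball of radius $R$ centred at $x\in\mathbb R^N$. Let $G\subset\mathbb R^N$ be a bounded domain (open, connected, non-empty) with boundary $\partial G$ of class $C^{2,\alpha}$, $0<\alpha\le 1$; that is, there are $r>0$ and $K,H\in\mathbb R$ such that for each $p\in\partial G$ there are a unit vector $\nu$ and a function $\varphi$ on the hyperplane $\nu^\perp$ with $\varphi(0)=0$, of class $C^2$ in the ball of radius $r$ about $0$, whose derivatives of order at most $2$ are bounded by $K$ there and whose second derivative is $\alpha$-Hölder continuous there with constant $H$, such that $G\cap B_r(p)=\{x\in B_r(p):(x-p)\cdot\nu<\varphi(\text{projection of }x-p\text{ on }\nu^\perp)\}$. The pair $(r,K)$ describes the $C^2$ regularity of $\partial G$. Let $\rho$ be the optimal radius of a uniform interior ball condition for $G$ (the supremum of the $s>0$ such that each point of $\partial G$ lies on the boundary of a ball of radius $s$ contained in $G$). Let $R>0$, $\Omega=G+B_R(0)$, and let $u\in C^2(\Omega)\cap C^0(\overline\Omega)$ satisfy $-\Delta u=1$ in $\Omega$, $u=0$ on $\partial\Omega$. Put $$[u]_{\partial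 G}=\sup_{x,y\in\partial G,\ x\ne y}\frac{|u(x)-u(y)|}{|x-y|}.$$ Let $\omega$ be a unit vector. For $\lambda\in\mathbb R$ let $\pi_\lambda=\{x:x\cdot\omega=\lambda\}$, $x^\lambda=x-2(x\cdot\omega-\lambda)\omega$, $G_\lambda=\{x\in G:x\cdot\omega>\lambda\}$, $G^\lambda=\{x:x^\lambda\in G_\lambda\}$, and let $$m=\inf\bigl\{\mu:\ G^\lambda\subset G\ \text{ for all }\lambda\in(\mu,\ \textstyle\sup_{x\in G}x\cdot\omega)\bigr\}.$$ Call $G_m$ the maximal cap and put $w^m(x)=u(x^m)-u(x)$. Consider the points of the two critical cases: (i) $P\in\partial G\setminus\pi_m$ at which $G^m\subset G$ is internally tangent to $\partial G$, i.e. $P\in\partial G\cap\partial(G^m)$; (ii) $Q\in\partial G\cap\pi_m$ at which $\pi_m$ is orthogonal to $\partial G$, i.e. $\omega$ is tangent to $\partial G$ at $Q$. Call a connected component of $G_m$ critical if it intersects $B_R(P^m)$ for some $P$ as in (i), or $B_R(Q)$ for some $Q$ as in (ii). Then at least one critical component exists, and on each critical component $\Sigma$ $$w^m(x)\le M\,C\,[u]_{\partial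 G}\qquad\text{for all }x\in\Sigma .$$ Here $$C=\max\Bigl(1,\frac{2\,\mathrm{diam}\,G}{\rho},2\rho\,C''\Bigr)\,\max\Bigl(R,\frac{\mathrm{diam}\,G}{2^{N-2}}\Bigr)\,C_N^{\,\left(2+\frac{\mathrm{diam}\,G}{R}\right)^N},\qquad C_N=3^{2^N}2^{(N-2)2^N},$$ where $M\ge1$ depends only on $N$ and $C''>0$ depends only on $N$, on $\rho$ and on the $C^2$ regularity $(r,K)$ of $\partial G$; in particular neither depends on $\omega$, $u$, $R$, $\alpha$ or $H$. -/

import Mathlib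

open scoped Pointwise RealInnerProductSpace Laplacian

noncomputable section

namespace MovingPlanes

/-- Euclidean space `ℝ^N`. -/
abbrev Euc (N : ℕ) : Type := EuclideanSpace ℝ (Fin N)

variable {N : ℕ}

/-- The reflection `x - 2 (x·ω - t) ω` of `x` about the hyperplane `{x | x·ω = t}`. -/
def reflPt (ω : Euc N) (t : ℝ) (x : Euc N) : Euc N :=
  x - (2 * (⟪x, ω⟫ - t)) • ω

/-- The right-hand cap `{x ∈ A | x·ω > t}` of a set `A`. -/
def cap (A : Set (Euc N)) (ω : Euc N) (t : ℝ) : Set (Euc N) :=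
  {x | x ∈ A ∧ t < ⟪x, ω⟫}

/-- The reflected cap: the points whose reflection belongs to the cap. -/
def reflCap (A : Set (Euc N)) (ω : Euc N) (t : ℝ) : Set (Euc N) :=
  {x | reflPt ω t x ∈ cap A ω t}

/-- The extent `sup {x·ω | x ∈ G}` of `G` in direction `ω`. -/
def extent (G : Set (Euc N)) (ω : Euc N) : ℝ :=
  sSup ((fun x : Euc N => ⟪x, ω⟫) '' G)

/-- The critical position `m` of the moving plane: the infimum of the `μ` such that the reflected
cap is contained in `G` for every position strictly between `μ` and the extent of `G`. -/
def critPos (G : Set (Euc N)) (ω : Euc N) : ℝ :=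
  sInf {μ : ℝ | ∀ t ∈ Set.Ioo μ (extent G ω), reflCap G ω t ⊆ G}

/-- The maximal cap `G_m`. -/
def maxCap (G : Set (Euc N)) (ω : Euc N) : Set (Euc N) :=
  cap G ω (critPos G ω)

/-- Critical case (i): the reflected maximal cap is internally tangent to the boundary of `G` at
the point `P`, which does not lie on the critical hyperplane. -/
def IsTangencyPoint (G : Set (Euc N)) (ω P : Euc N) : Prop :=
  P ∈ frontier G ∧ ⟪P, ω⟫ ≠ critPos G ω ∧
    reflCap G ω (critPos G ω) ⊆ G ∧ P ∈ frontier (reflCap G ω (critPos G ω))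

/-- Critical case (ii): the critical hyperplane is orthogonal to the boundary of `G` at the point
`Q`, which lies on both; that is, `ω` is a tangent vector to the boundary of `G` at `Q`. -/
def IsOrthogonalityPoint (G : Set (Euc N)) (ω Q : Euc N) : Prop :=
  Q ∈ frontier G ∧ ⟪Q, ω⟫ = critPos G ω ∧ ω ∈ tangentConeAt ℝ (frontier G) Q

/-- `S` is one of the connected components of the maximal cap that the moving-plane method singles
out: it intersects the ball of radius `R` centred at the reflection of a tangency point, or centred
at an orthogonality point. -/
def IsCriticalComponent (G : Set (Euc N)) (R : ℝ) (ω : Euc N) (S : Set (Euc N)) : Prop :=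
  (∃ x ∈ maxCap G ω, S = connectedComponentIn (maxCap G ω) x) ∧
    ((∃ P, IsTangencyPoint G ω P ∧
        (S ∩ Metric.ball (reflPt ω (critPos G ω) P) R).Nonempty) ∨
      (∃ Q, IsOrthogonalityPoint G ω Q ∧ (S ∩ Metric.ball Q R).Nonempty))

/-- The boundary of the open set `G` is of class `C^{2,α}`: near each of its points `G` is the
subgraph, in the direction of some unit vector `ν`, of a `C^2` function `φ` on the hyperplane
orthogonal to `ν`, with Hölder continuous second derivatives. The radius `r` of the charts and the
bound `K` for the derivatives of `φ` of order at most two quantify the `C^2` regularity; the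
number `H` bounds the `α`-Hölder seminorm of the second derivatives. -/
def HasHolderBoundary (G : Set (Euc N)) (r K α H : ℝ) : Prop :=
  ∀ p ∈ frontier G, ∃ ν : Euc N, ‖ν‖ = 1 ∧
    ∃ φ : (Submodule.span ℝ {ν})ᗮ → ℝ,
      φ 0 = 0 ∧
      ContDiffOn ℝ 2 φ (Metric.ball 0 r) ∧
      (∀ i ≤ 2, ∀ y ∈ Metric.ball 0 r, ‖iteratedFDeriv ℝ i φ y‖ ≤ K) ∧
      (∀ y ∈ Metric.ball 0 r, ∀ z ∈ Metric.ball 0 r,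
        ‖iteratedFDeriv ℝ 2 φ y - iteratedFDeriv ℝ 2 φ z‖ ≤ H * ‖y - z‖ ^ α) ∧
      ∀ x ∈ Metric.ball p r,
        (x ∈ G ↔ ⟪x - p, ν⟫ < φ ((Submodule.span ℝ {ν})ᗮ.orthogonalProjectionOnto (x - p)))

/-- The optimal radius `ρ` of a uniform interior ball condition: the supremum of the radii `s`
such that every boundary point of `G` lies on the boundary of a ball of radius `s` inside `G`. -/
def interiorBallRadius (G : Set (Euc N)) : ℝ :=
  sSup {s : ℝ | 0 < s ∧ ∀ p ∈ frontier G, ∃ c : Euc N, dist c p = s ∧ Metric.ball c s ⊆ G}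

/-- The semi-norm `[u]_Γ`: the supremum of `|u x - u y| / |x - y|` over distinct `x, y ∈ Γ`. -/
def lipSeminorm (Γ : Set (Euc N)) (u : Euc N → ℝ) : ℝ :=
  sSup {q : ℝ | ∃ x ∈ Γ, ∃ y ∈ Γ, x ≠ y ∧ q = |u x - u y| / dist x y}

/-- `u ∈ C^2(Ω) ∩ C^0(closure Ω)` solves `-Δu = 1` in `Ω`, `u = 0` on the boundary of `Ω`. -/
structure IsTorsionSolution (Ω : Set (Euc N)) (u : Euc N → ℝ) : Prop where
  contDiffOn : ContDiffOn ℝ 2 u Ω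
  continuousOn : ContinuousOn u (closure Ω)
  eqn : ∀ x ∈ Ω, -(Δ u) x = 1
  boundary : ∀ x ∈ frontier Ω, u x = 0

/-- The reflected difference `w^m(x) = u(x^m) - u(x)`. -/
def reflDiff (G : Set (Euc N)) (ω : Euc N) (u : Euc N → ℝ) (x : Euc N) : ℝ :=
  u (reflPt ω (critPos G ω) x) - u x

/-- `C_N = 3^(2^N) * 2^((N-2) 2^N)`; the exponent `N - 2` is an integer. -/
def harnackBase (N : ℕ) : ℝ :=
  3 ^ (2 ^ N) * (2 : ℝ) ^ (((N : ℤ) - 2) * 2 ^ N)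

/-- The constant
`C = max (1, 2d/ρ, 2ρC'') * max (R, d/2^(N-2)) * C_N ^ ((2 + d/R)^N)`,
where `d` is the diameter of `G`, `ρ` its interior ball radius and `c` stands for `C''`. -/
def capConst (N : ℕ) (R d ρ c : ℝ) : ℝ :=
  max 1 (max (2 * d / ρ) (2 * ρ * c)) * max R (d / (2 : ℝ) ^ ((N : ℤ) - 2)) *
    harnackBase N ^ ((2 + d / R) ^ N)

end MovingPlanes

end

/-! Write `w` for the difference `u(x^m) - u(x)`. It is harmonic where both terms are defined, odd
about the critical plane and, by the minimum principle, nonnegative on the right of it. Dividing by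
the distance to the plane gives `planeQuot`, which can be read as a positive axially symmetric
harmonic function in dimension `N + 2`, regular across the plane. It therefore obeys a Harnack
inequality on balls `B_R(x)` centred in the closed cap, however close `x` is to the plane. No
separate boundary estimate is needed.

The inequality is proved without changing dimension. Averages against `(r² - |z - x|²)₊` reproduce
harmonic functions, and `capKerDiff_mul_le` compares the antisymmetrised kernels of nested balls. A
chain of Harnack balls along a path in a component, its length controlled by volume packing, gives
`IsOddHarmonic.planeQuot_le_of_joinedIn`.

At a tangency point `P` the segment from `P` to `P^m` has twice the length of the distance to the
plane, so the quotient at `P^m` is at most `2 [u]`. At an orthogonality point the quotient tends to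
`-2 ∂_ω u(Q)`, bounded by `2 [u]` because `ω` is tangential. Since the cap has width at most `diam G
/ 2`, multiplying back by the distance gives the bound on `w`. Existence of a critical component
comes from a compactness argument at plane positions where the reflected cap leaves `G`. -/

noncomputable section

namespace MovingPlanes

open Set Filter Topology MeasureTheory Metric

/-! ### Second derivatives at a minimum, and invariance of the Laplacian under isometries. -/

section Laplacian

variable {E : Type*} [NormedAddCommGroup E] [InnerProductSpace ℝ E]

theorem _root_.ContDiffAt.differentiableAt_fderiv {f : E → ℝ} {x : E} (hf : ContDiffAt ℝ 2 f x) :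
    DifferentiableAt ℝ (fderiv ℝ f) x :=
  (hf.fderiv_right (m := 1) (by norm_num)).differentiableAt (by norm_num)

theorem _root_.ContDiffAt.eventually_differentiableAt {f : E → ℝ} {x : E}
    (hf : ContDiffAt ℝ 2 f x) : ∀ᶠ y in 𝓝 x, DifferentiableAt ℝ f y := by
  filter_upwards [hf.eventually (by simp)] with y hy
  exact hy.differentiableAt (by norm_num)

/-- A negative second derivative along a line would make the point a local maximum on that line too;
the restriction would then be locally constant, with vanishing second derivative. -/
theorem fderiv_fderiv_nonneg_of_isLocalMin {f : E → ℝ} {x : E} (hf : ContDiffAt ℝ 2 f x)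
    (hmin : IsLocalMin f x) (e : E) : 0 ≤ fderiv ℝ (fderiv ℝ f) x e e := by
  by_contra! hneg
  set l : ℝ → E := fun t => x + t • e with hl
  have hl0 : l 0 = x := by simp [hl]
  have hlc : Tendsto l (𝓝 0) (𝓝 x) := by
    have : Continuous l := by fun_prop
    simpa [hl0] using this.tendsto 0
  have hld : ∀ t, HasDerivAt l e t := fun t => by
    simpa [hl] using ((hasDerivAt_id t).smul_const e).const_add x
  have h1 : ∀ᶠ t in 𝓝 (0 : ℝ), HasDerivAt (f ∘ l) (fderiv ℝ f (l t) e) t := by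
    filter_upwards [hlc.eventually hf.eventually_differentiableAt] with t ht
    exact ht.hasFDerivAt.comp_hasDerivAt t (hld t)
  have h2 : deriv (f ∘ l) =ᶠ[𝓝 0] fun t => fderiv ℝ f (l t) e := h1.mono fun t ht => ht.deriv
  have h3 : HasDerivAt (fun t => fderiv ℝ f (l t) e) (fderiv ℝ (fderiv ℝ f) x e e) 0 := by
    have hd := hf.differentiableAt_fderiv.hasFDerivAt
    rw [← hl0] at hd
    have := (hd.comp_hasDerivAt (0 : ℝ) (hld 0)).clm_apply (hasDerivAt_const (0 : ℝ) e)
    simpa [hl0] using this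
  have h4 : deriv (deriv (f ∘ l)) 0 = fderiv ℝ (fderiv ℝ f) x e e := by
    rw [h2.deriv_eq, h3.deriv]
  have h5 : IsLocalMin (f ∘ l) 0 := by
    have := hlc.eventually hmin
    filter_upwards [this] with t ht
    simpa [hl0] using ht
  have h6 : IsLocalMax (f ∘ l) 0 :=
    isLocalMax_of_deriv_deriv_neg (by rw [h4]; exact hneg) h5.deriv_eq_zero
      h1.self_of_nhds.continuousAt
  have h7 : (f ∘ l) =ᶠ[𝓝 0] fun _ => (f ∘ l) 0 := by
    filter_upwards [h5, h6] with t ht ht' using le_antisymm ht' ht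
  have h8 : deriv (f ∘ l) =ᶠ[𝓝 0] fun _ => 0 := by
    refine h7.deriv.trans ?_
    simp
  have h9 : deriv (deriv (f ∘ l)) 0 = 0 := by rw [h8.deriv_eq]; simp
  linarith

theorem fderiv_fderiv_comp_affine {L : E →L[ℝ] E} {c x : E} {f : E → ℝ}
    (hf : ContDiffAt ℝ 2 f (L x + c)) (e : E) :
    fderiv ℝ (fderiv ℝ fun y => f (L y + c)) x e e =
      fderiv ℝ (fderiv ℝ f) (L x + c) (L e) (L e) := by
  have hσ : ∀ y, HasFDerivAt (fun y => L y + c) L y := fun y => L.hasFDerivAt.add_const c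
  have hc : Tendsto (fun y => L y + c) (𝓝 x) (𝓝 (L x + c)) := (hσ x).continuousAt
  have h1 : (fderiv ℝ fun y => f (L y + c)) =ᶠ[𝓝 x] fun y => (fderiv ℝ f (L y + c)).comp L := by
    filter_upwards [hc.eventually hf.eventually_differentiableAt] with y hy
    exact (hy.hasFDerivAt.comp y (hσ y)).fderiv
  have h2 : HasFDerivAt (fun y => fderiv ℝ f (L y + c))
      ((fderiv ℝ (fderiv ℝ f) (L x + c)).comp L) x :=
    HasFDerivAt.comp (g := fderiv ℝ f) x hf.differentiableAt_fderiv.hasFDerivAt (hσ x)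
  have h3 := h2.clm_comp (hasFDerivAt_const L x)
  rw [h1.fderiv_eq, h3.fderiv]
  simp

variable [FiniteDimensional ℝ E]

theorem laplacian_eq_sum_fderiv_fderiv {ι : Type*} [Fintype ι] (b : OrthonormalBasis ι ℝ E)
    (f : E → ℝ) (x : E) :
    (Δ f) x = ∑ i, fderiv ℝ (fderiv ℝ f) x (b i) (b i) := by
  rw [InnerProductSpace.laplacian_eq_iteratedFDeriv_orthonormalBasis f b]
  simp [iteratedFDeriv_two_apply]

theorem laplacian_nonneg_of_isLocalMin {f : E → ℝ} {x : E} (hf : ContDiffAt ℝ 2 f x)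
    (hmin : IsLocalMin f x) : 0 ≤ (Δ f) x := by
  rw [laplacian_eq_sum_fderiv_fderiv (stdOrthonormalBasis ℝ E)]
  exact Finset.sum_nonneg fun i _ => fderiv_fderiv_nonneg_of_isLocalMin hf hmin _

theorem laplacian_comp_isometry_add (L : E ≃ₗᵢ[ℝ] E) {c x : E} {f : E → ℝ}
    (hf : ContDiffAt ℝ 2 f (L x + c)) :
    (Δ fun y => f (L y + c)) x = (Δ f) (L x + c) := by
  set b := stdOrthonormalBasis ℝ E
  rw [laplacian_eq_sum_fderiv_fderiv b, laplacian_eq_sum_fderiv_fderiv (b.map L)]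
  refine Finset.sum_congr rfl fun i _ => ?_
  simpa using fderiv_fderiv_comp_affine (L := (L.toContinuousLinearEquiv : E →L[ℝ] E)) hf (b i)

end Laplacian

/-! ### The mean value property for the kernel `(r² - |z - x|²)₊`. -/

section MeanValue

variable {E : Type*} [NormedAddCommGroup E]

/-- The kernel `(r² - |z - x|²)₊` whose averages reproduce harmonic functions. -/
def capKer (r : ℝ) (x z : E) : ℝ := max (r ^ 2 - ‖z - x‖ ^ 2) 0

theorem capKer_nonneg (r : ℝ) (x z : E) : 0 ≤ capKer r x z := le_max_right _ _

theorem continuous_capKer (r : ℝ) (x : E) : Continuous (capKer r x) := by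
  unfold capKer; fun_prop

theorem capKer_eq_zero {r : ℝ} {x z : E} (hr : 0 ≤ r) (h : r ≤ ‖z - x‖) : capKer r x z = 0 := by
  refine max_eq_right ?_
  nlinarith [norm_nonneg (z - x)]

/-- The kernel has a kink on the sphere, but its square is differentiable everywhere, which is what
the integration by parts needs. -/
theorem hasDerivAt_max_zero_sq (t : ℝ) :
    HasDerivAt (fun s : ℝ => max s 0 ^ 2) (2 * max t 0) t := by
  rcases lt_trichotomy t 0 with h | h | h
  · rw [max_eq_right h.le, mul_zero]
    refine (hasDerivAt_const t (0 : ℝ)).congr_of_eventuallyEq ?_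
    filter_upwards [eventually_lt_nhds h] with s hs
    simp [max_eq_right hs.le]
  · subst h
    rw [hasDerivAt_iff_isLittleO]
    simp only [max_self, ne_eq, OfNat.ofNat_ne_zero, not_false_eq_true, zero_pow, sub_zero,
      mul_zero, smul_zero]
    refine Asymptotics.IsBigO.trans_isLittleO (g := fun s : ℝ => s ^ 2) ?_ ?_
    · refine Asymptotics.IsBigO.of_bound 1 (Eventually.of_forall fun s => ?_)
      rw [one_mul, Real.norm_of_nonneg (sq_nonneg _), Real.norm_of_nonneg (sq_nonneg _)]
      rcases le_total s 0 with hs | hs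
      · simp [max_eq_right hs, sq_nonneg]
      · simp [max_eq_left hs]
    · exact Asymptotics.isLittleO_pow_id one_lt_two
  · rw [max_eq_left h.le]
    have : HasDerivAt (fun s : ℝ => s ^ 2) (2 * t) t := by simpa using hasDerivAt_pow 2 t
    refine this.congr_of_eventuallyEq ?_
    filter_upwards [eventually_gt_nhds h] with s hs
    simp [max_eq_left hs.le]

variable [InnerProductSpace ℝ E]

theorem hasFDerivAt_capKer_sq (r : ℝ) (z : E) :
    HasFDerivAt (fun z : E => capKer r 0 z ^ 2) ((-4 * capKer r 0 z) • innerSL ℝ z) z := by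
  have h1 : HasFDerivAt (fun z : E => r ^ 2 - ‖z‖ ^ 2) (-(2 • innerSL ℝ z)) z := by
    simpa using ((hasStrictFDerivAt_norm_sq z).hasFDerivAt).const_sub (r ^ 2)
  have h2 := (hasDerivAt_max_zero_sq (r ^ 2 - ‖z‖ ^ 2)).comp_hasFDerivAt z h1
  have : (fun z : E => capKer r 0 z ^ 2)
      = (fun s : ℝ => max s 0 ^ 2) ∘ fun z : E => r ^ 2 - ‖z‖ ^ 2 := by
    ext z; simp [capKer]
  rw [this]
  refine h2.congr_fderiv ?_
  ext v
  simp [capKer]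
  ring

variable [FiniteDimensional ℝ E]

theorem hasCompactSupport_capKer {r : ℝ} (hr : 0 ≤ r) (x : E) :
    HasCompactSupport (capKer r x) := by
  refine HasCompactSupport.intro (isCompact_closedBall x r) fun z hz => capKer_eq_zero hr ?_
  rw [mem_closedBall, dist_eq_norm, not_le] at hz
  exact hz.le

variable [MeasurableSpace E] [BorelSpace E]

theorem integrable_mul_capKer {r : ℝ} (hr : 0 ≤ r) (x : E) {g : E → ℝ} (hg : Continuous g) :
    Integrable (fun z => g z * capKer r x z) :=
  (hg.mul (continuous_capKer r x)).integrable_of_hasCompactSupport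
    (hasCompactSupport_capKer hr x).mul_left

/-- The gradient of `capKer²` is `-4 capKer ζ`, so the integrand is a multiple of `∇w · ∇(capKer²)`;
integrating by parts leaves `Δw` against `capKer²`. -/
theorem integral_fderiv_mul_capKer_eq_zero {w : E → ℝ} {x : E} {s : ℝ} (hw : ContDiff ℝ 2 w)
    (hs : ∀ ζ ∈ ball (0 : E) 1, (Δ w) (x + s • ζ) = 0) :
    ∫ ζ, fderiv ℝ w (x + s • ζ) ζ * capKer 1 0 ζ = 0 := by
  set b := stdOrthonormalBasis ℝ E
  have hd : Continuous (fderiv ℝ w) := hw.continuous_fderiv (by norm_num)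
  have hdd : Continuous (fderiv ℝ (fderiv ℝ w)) :=
    (hw.fderiv_right (m := 1) (by norm_num)).continuous_fderiv (by norm_num)
  have hl : Continuous fun ζ : E => x + s • ζ := by fun_prop
  have hker := continuous_capKer (E := E) 1 0
  have hsupp := hasCompactSupport_capKer (E := E) zero_le_one 0
  have hfd : ∀ i ζ, HasFDerivAt (fun ζ : E => fderiv ℝ w (x + s • ζ) (b i))
      (s • (fderiv ℝ (fderiv ℝ w) (x + s • ζ)).flip (b i)) ζ := fun i ζ => by
    have h1 : HasFDerivAt (fun ζ : E => x + s • ζ) (s • ContinuousLinearMap.id ℝ E) ζ :=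
      ((hasFDerivAt_id ζ).const_smul s).const_add x
    have h2 := HasFDerivAt.comp (g := fderiv ℝ w) ζ
      hw.contDiffAt.differentiableAt_fderiv.hasFDerivAt h1
    exact (h2.clm_apply (hasFDerivAt_const (b i) ζ)).congr_fderiv (by ext v; simp)
  have key : ∀ i, ∫ ζ, fderiv ℝ w (x + s • ζ) (b i) * (-4 * capKer 1 0 ζ * ⟪ζ, b i⟫)
      = - ∫ ζ, s * fderiv ℝ (fderiv ℝ w) (x + s • ζ) (b i) (b i) * capKer 1 0 ζ ^ 2 := fun i => by
    have := integral_mul_fderiv_eq_neg_fderiv_mul_of_integrable (μ := (volume : Measure E))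
      (f := fun ζ : E => fderiv ℝ w (x + s • ζ) (b i)) (g := fun ζ => capKer 1 0 ζ ^ 2)
      (v := b i) ?_ ?_ ?_ (fun ζ _ => (hfd i ζ).differentiableAt)
      (fun ζ _ => (hasFDerivAt_capKer_sq 1 ζ).differentiableAt)
    · simp only [(hasFDerivAt_capKer_sq _ _).fderiv, (hfd i _).fderiv] at this
      simpa using this
    · simp only [(hfd i _).fderiv]
      refine Continuous.integrable_of_hasCompactSupport (by simp; fun_prop) ?_
      exact (hsupp.comp_left (g := fun t => t ^ 2) (by simp)).mul_left
    · simp only [(hasFDerivAt_capKer_sq _ _).fderiv]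
      refine Continuous.integrable_of_hasCompactSupport (by simp; fun_prop) ?_
      refine HasCompactSupport.mul_left ?_
      simp only [smul_apply]
      exact (hsupp.mul_left (f := fun _ => (-4 : ℝ))).smul_right
    · refine Continuous.integrable_of_hasCompactSupport (by fun_prop) ?_
      exact (hsupp.comp_left (g := fun t => t ^ 2) (by simp)).mul_left
  have hint1 : ∀ i ∈ Finset.univ, Integrable fun ζ : E =>
      fderiv ℝ w (x + s • ζ) (b i) * (-4 * capKer 1 0 ζ * ⟪ζ, b i⟫) := fun i _ => by
    refine Continuous.integrable_of_hasCompactSupport (by fun_prop) ?_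
    exact HasCompactSupport.mul_left ((hsupp.mul_left (f := fun _ => (-4 : ℝ))).mul_right)
  have hint2 : ∀ i ∈ Finset.univ, Integrable fun ζ : E =>
      s * fderiv ℝ (fderiv ℝ w) (x + s • ζ) (b i) (b i) * capKer 1 0 ζ ^ 2 := fun i _ => by
    refine Continuous.integrable_of_hasCompactSupport (by fun_prop) ?_
    exact (hsupp.comp_left (g := fun t => t ^ 2) (by simp)).mul_left
  have hsum := Finset.sum_congr (rfl : Finset.univ = Finset.univ) fun i _ => key i
  rw [Finset.sum_neg_distrib, ← integral_finsetSum _ hint1, ← integral_finsetSum _ hint2] at hsum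
  have hR : ∫ ζ, ∑ i, s * fderiv ℝ (fderiv ℝ w) (x + s • ζ) (b i) (b i) * capKer 1 0 ζ ^ 2 = 0 := by
    rw [← integral_zero E ℝ]
    refine integral_congr_ae (Eventually.of_forall fun ζ => ?_)
    simp only
    rw [← Finset.sum_mul, ← Finset.mul_sum, ← laplacian_eq_sum_fderiv_fderiv b]
    by_cases hζ : ζ ∈ ball (0 : E) 1
    · simp [hs ζ hζ]
    · rw [capKer_eq_zero zero_le_one (by simpa using hζ)]; simp
  have hLeq : ∀ ζ, ∑ i, fderiv ℝ w (x + s • ζ) (b i) * (-4 * capKer 1 0 ζ * ⟪ζ, b i⟫)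
      = -4 * (fderiv ℝ w (x + s • ζ) ζ * capKer 1 0 ζ) := fun ζ => by
    conv_rhs => rw [← b.sum_repr' ζ]
    rw [map_sum, Finset.sum_mul, Finset.mul_sum]
    refine Finset.sum_congr rfl fun i _ => ?_
    rw [map_smul, smul_eq_mul, real_inner_comm, b.sum_repr']
    ring
  simp only [hLeq] at hsum
  rw [hR, integral_const_mul] at hsum
  linarith

/-- Averages of a harmonic function against the kernel `capKer` do not depend on the radius. -/
theorem integral_comp_mul_capKer {w : E → ℝ} {x : E} {R : ℝ} (hw : ContDiff ℝ 2 w)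
    (hΔ : ∀ z ∈ ball x R, (Δ w) z = 0) {r : ℝ} (hr : 0 ≤ r) (hrR : r ≤ R) :
    ∫ ζ, w (x + r • ζ) * capKer 1 0 ζ = w x * ∫ ζ : E, capKer 1 0 ζ := by
  set φ : ℝ → ℝ := fun s => ∫ ζ, w (x + s • ζ) * capKer 1 0 ζ with hφ
  have hd : Continuous (fderiv ℝ w) := hw.continuous_fderiv (by norm_num)
  have hwc := hw.continuous
  have hker := continuous_capKer (E := E) 1 0
  have hsupp := hasCompactSupport_capKer (E := E) zero_le_one 0
  -- The `s`-derivative of the average is the integral just shown to vanish.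
  have hderiv : ∀ s, HasDerivAt φ (∫ ζ, fderiv ℝ w (x + s • ζ) ζ * capKer 1 0 ζ) s := fun s => by
    obtain ⟨C, hC⟩ := (((isCompact_closedBall s 1).prod (isCompact_closedBall (0 : E) 1)).image
      (f := fun p : ℝ × E => fderiv ℝ w (x + p.1 • p.2) p.2) (by fun_prop)).isBounded.exists_norm_le
    refine (hasDerivAt_integral_of_dominated_loc_of_deriv_le (bound := fun ζ => C * capKer 1 0 ζ)
      (F := fun s ζ => w (x + s • ζ) * capKer 1 0 ζ)
      (F' := fun s ζ => fderiv ℝ w (x + s • ζ) ζ * capKer 1 0 ζ)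
      (ball_mem_nhds s one_pos) ?_ ?_ ?_ ?_ ?_ ?_).2
    · exact Eventually.of_forall fun s => by
        have : Continuous fun ζ : E => w (x + s • ζ) * capKer 1 0 ζ := by fun_prop
        exact this.aestronglyMeasurable
    · exact integrable_mul_capKer zero_le_one _ (by fun_prop)
    · exact (integrable_mul_capKer zero_le_one _ (by fun_prop)).aestronglyMeasurable
    · refine Eventually.of_forall fun ζ t ht => ?_
      rw [norm_mul, Real.norm_of_nonneg (capKer_nonneg _ _ _)]
      by_cases hζ : ζ ∈ closedBall (0 : E) 1
      · exact mul_le_mul_of_nonneg_right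
          (hC _ ⟨(t, ζ), ⟨ball_subset_closedBall ht, hζ⟩, rfl⟩) (capKer_nonneg _ _ _)
      · rw [capKer_eq_zero zero_le_one (by simpa using (not_le.1 (by simpa using hζ)).le)]
        simp
    · exact integrable_mul_capKer zero_le_one _ continuous_const
    · refine Eventually.of_forall fun ζ t _ => ?_
      have h1 : HasDerivAt (fun t : ℝ => x + t • ζ) ζ t := by
        simpa using ((hasDerivAt_id t).smul_const ζ).const_add x
      exact ((hw.differentiable (by norm_num) _).hasFDerivAt.comp_hasDerivAt t h1).mul_const _
  have hconst : φ r = φ 0 := by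
    refine constant_of_has_deriv_right_zero (fun s _ => (hderiv s).continuousAt.continuousWithinAt)
      (fun s hs => ?_) r ⟨hr, le_rfl⟩
    rw [← integral_fderiv_mul_capKer_eq_zero (x := x) (s := s) hw fun ζ hζ => hΔ _ ?_]
    · exact (hderiv s).hasDerivWithinAt
    · rw [mem_ball_zero_iff] at hζ
      rw [mem_ball, dist_eq_norm, add_sub_cancel_left, norm_smul, Real.norm_of_nonneg hs.1]
      nlinarith [hs.1, hs.2]
  have h0 : φ 0 = w x * ∫ ζ : E, capKer 1 0 ζ := by
    simp [hφ, integral_const_mul]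
  rw [← h0, ← hconst]

end MeanValue

section MeanValue

variable {E : Type*} [NormedAddCommGroup E] [InnerProductSpace ℝ E]

theorem capKer_add_smul {r : ℝ} (x ζ : E) :
    capKer r x (x + r • ζ) = r ^ 2 * capKer 1 0 ζ := by
  unfold capKer
  rw [mul_max_of_nonneg _ _ (sq_nonneg r), add_sub_cancel_left, norm_smul, mul_pow, sub_zero,
    Real.norm_eq_abs, sq_abs, mul_zero]
  congr 1; ring

variable [FiniteDimensional ℝ E]

/-- A cutoff allows the integral identities to be stated for functions that are `C²` on the whole
space. -/
theorem exists_contDiff_eqOn {K D : Set E} (hK : IsCompact K) (hD : IsOpen D) (hKD : K ⊆ D)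
    {w : E → ℝ} (hw : ContDiffOn ℝ 2 w D) : ∃ v : E → ℝ, ContDiff ℝ 2 v ∧ EqOn v w K := by
  obtain ⟨U, hU, hKU, hUD⟩ := exists_open_between_and_isCompact_closure hK hD hKD
  obtain ⟨f, hf0, hf1, -⟩ := exists_contMDiffMap_zero_one_of_isClosed (n := 2) (modelWithCornersSelf ℝ E)
    hU.isClosed_compl hK.isClosed (disjoint_left.2 fun z hz hz' => hz (hKU hz'))
  refine ⟨fun z => f z * w z, contDiff_iff_contDiffAt.2 fun z => ?_, fun z hz => ?_⟩
  · by_cases hz : z ∈ D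
    · exact f.contMDiff.contDiff.contDiffAt.mul (hw.contDiffAt (hD.mem_nhds hz))
    · have hz' : z ∈ (closure U)ᶜ := fun h => hz (hUD.1 h)
      refine (contDiffAt_const (c := (0 : ℝ))).congr_of_eventuallyEq ?_
      filter_upwards [isClosed_closure.isOpen_compl.mem_nhds hz'] with y hy
      rw [hf0 (fun h => hy (subset_closure h))]
      simp
  · simp [hf1 hz]

variable [MeasurableSpace E] [BorelSpace E]

/-- Mean value property of harmonic functions for the kernel `capKer`. -/
theorem integral_mul_capKer {w : E → ℝ} {x : E} {R : ℝ} (hw : ContDiff ℝ 2 w)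
    (hΔ : ∀ z ∈ ball x R, (Δ w) z = 0) {r : ℝ} (hr : 0 < r) (hrR : r ≤ R) :
    ∫ z, w z * capKer r x z
      = r ^ (Module.finrank ℝ E + 2) * w x * ∫ ζ : E, capKer 1 0 ζ := by
  have h1 := integral_comp_mul_capKer hw hΔ hr.le hrR
  have h2 : ∫ ζ : E, w (x + r • ζ) * capKer r x (x + r • ζ)
      = |(r ^ Module.finrank ℝ E)⁻¹| • ∫ z, w z * capKer r x z := by
    rw [Measure.integral_comp_smul volume (fun z => w (x + z) * capKer r x (x + z)),
      integral_add_left_eq_self (fun z => w z * capKer r x z)]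
  simp only [capKer_add_smul, mul_left_comm _ (r ^ 2), integral_const_mul, h1, smul_eq_mul,
    abs_inv, abs_of_pos (pow_pos hr _)] at h2
  have := pow_pos hr (Module.finrank ℝ E)
  field_simp at h2
  rw [← h2]; ring

theorem integral_capKer_pos : 0 < ∫ ζ : E, capKer 1 0 ζ := by
  have hi : Integrable fun ζ : E => capKer 1 0 ζ := by
    simpa using integrable_mul_capKer zero_le_one (0 : E) (continuous_const (y := (1 : ℝ)))
  rw [integral_pos_iff_support_of_nonneg (fun ζ => capKer_nonneg _ _ _) hi]
  refine lt_of_lt_of_le (measure_ball_pos volume (0 : E) one_pos) (measure_mono fun ζ hζ => ?_)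
  rw [mem_ball_zero_iff] at hζ
  have : 0 < 1 ^ 2 - ‖ζ - 0‖ ^ 2 := by
    rw [sub_zero]; nlinarith [norm_nonneg ζ]
  exact (lt_max_of_lt_left this).ne'

end MeanValue

/-! ### Reflections and comparison of antisymmetrised kernels. -/

section Reflection

variable {N : ℕ} {ω : Euc N} {t : ℝ}

theorem inner_reflPt (hω : ‖ω‖ = 1) (x : Euc N) :
    ⟪reflPt ω t x, ω⟫ = 2 * t - ⟪x, ω⟫ := by
  simp [reflPt, inner_sub_left, inner_smul_left, hω]
  ring

theorem reflPt_reflPt (hω : ‖ω‖ = 1) (x : Euc N) : reflPt ω t (reflPt ω t x) = x := by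
  conv_lhs => unfold reflPt
  rw [show x - (2 * (⟪x, ω⟫ - t)) • ω = reflPt ω t x from rfl, inner_reflPt hω, reflPt]
  module

theorem reflPt_eq_self {x : Euc N} (hx : ⟪x, ω⟫ = t) : reflPt ω t x = x := by
  simp [reflPt, hx]

/-- The linear part of the reflection about a hyperplane orthogonal to `ω`. -/
def reflIso (ω : Euc N) : Euc N ≃ₗᵢ[ℝ] Euc N := (ℝ ∙ ω)ᗮ.reflection

theorem reflPt_eq (hω : ‖ω‖ = 1) (x : Euc N) :
    reflPt ω t x = reflIso ω x + (2 * t) • ω := by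
  rw [reflIso, Submodule.reflection_orthogonal_apply, Submodule.reflection_singleton_apply, hω,
    real_inner_comm, reflPt]
  simp
  module

theorem dist_reflPt_reflPt (hω : ‖ω‖ = 1) (x y : Euc N) :
    dist (reflPt ω t x) (reflPt ω t y) = dist x y := by
  rw [reflPt_eq hω, reflPt_eq hω, dist_add_right, LinearIsometryEquiv.dist_map]

theorem continuous_reflPt : Continuous (reflPt ω t) := by unfold reflPt; fun_prop

theorem measurePreserving_reflPt (hω : ‖ω‖ = 1) :
    MeasurePreserving (reflPt ω t) volume volume := by
  have := (measurePreserving_add_right volume ((2 * t) • ω)).comp (reflIso ω).measurePreserving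
  have h : reflPt ω t = (fun x => x + (2 * t) • ω) ∘ reflIso ω := funext fun x => reflPt_eq hω x
  rwa [h]

/-- Used repeatedly through the sign of the last term: reflecting moves `z` away from points on its
own side and towards points on the other. -/
theorem norm_reflPt_sub_sq (hω : ‖ω‖ = 1) (x z : Euc N) :
    ‖reflPt ω t z - x‖ ^ 2 = ‖z - x‖ ^ 2 + 4 * ((⟪x, ω⟫ - t) * (⟪z, ω⟫ - t)) := by
  have : reflPt ω t z - x = (z - x) - (2 * (⟪z, ω⟫ - t)) • ω := by rw [reflPt]; abel
  rw [this, norm_sub_sq_real, inner_smul_right, norm_smul, hω, inner_sub_left, Real.norm_eq_abs,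
    mul_one, sq_abs]
  ring

theorem laplacian_comp_reflPt (hω : ‖ω‖ = 1) {x : Euc N} {f : Euc N → ℝ}
    (hf : ContDiffAt ℝ 2 f (reflPt ω t x)) :
    (Δ fun y => f (reflPt ω t y)) x = (Δ f) (reflPt ω t x) := by
  simp only [reflPt_eq hω] at hf ⊢
  exact laplacian_comp_isometry_add (reflIso ω) hf

/-- The difference of the kernel `capKer` and its reflection. -/
def capKerDiff (ω : Euc N) (t r : ℝ) (x z : Euc N) : ℝ :=
  capKer r x z - capKer r x (reflPt ω t z)

/-- Comparison of the reflected kernels of two nested balls. Divided by the distance of the centre to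
the hyperplane, `capKerDiff` is the average over rotations of the indicator function of a ball in two
more dimensions, and the inequality is the inclusion of these balls. -/
theorem capKerDiff_mul_le (hω : ‖ω‖ = 1) {r R : ℝ} {x y z : Euc N} (hr : 0 ≤ r)
    (hx : t < ⟪x, ω⟫) (hy : t < ⟪y, ω⟫) (hz : t < ⟪z, ω⟫) (hxy : ‖y - x‖ + r ≤ R) :
    capKerDiff ω t r y z * (⟪x, ω⟫ - t) ≤ capKerDiff ω t R x z * (⟪y, ω⟫ - t) := by
  set x₁ := ⟪x, ω⟫ - t with hx₁
  set y₁ := ⟪y, ω⟫ - t with hy₁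
  set z₁ := ⟪z, ω⟫ - t with hz₁
  have hx0 : 0 < x₁ := sub_pos.2 hx
  have hy0 : 0 < y₁ := sub_pos.2 hy
  have hz0 : 0 < z₁ := sub_pos.2 hz
  -- Rotate `z` about the plane into two extra dimensions. The rotated point has component `p = z -
  -- (τ/2)ω` in the original space and extra squared length `z₁τ - τ²/4`; `τ` from `0` to `4 z₁`
  -- runs from `z` to its mirror image. The hypothesis places this point in the ball of radius `r`
  -- about `y`, the conclusion in the ball of radius `R` about `x`.
  have key : ∀ τ, 0 ≤ τ → τ ≤ 4 * z₁ → τ * y₁ ≤ r ^ 2 - ‖z - y‖ ^ 2 →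
      τ * x₁ ≤ R ^ 2 - ‖z - x‖ ^ 2 := fun τ h0 h4 h => by
    set p := z - (τ / 2) • ω with hp
    have e1 : ∀ a : Euc N, ‖p - a‖ ^ 2 = ‖z - a‖ ^ 2 - τ * (⟪z, ω⟫ - ⟪a, ω⟫) + τ ^ 2 / 4 :=
      fun a => by
        have : p - a = (z - a) - (τ / 2) • ω := by rw [hp]; abel
        rw [this, norm_sub_sq_real, inner_smul_right, norm_smul, hω, inner_sub_left,
          Real.norm_eq_abs, mul_one, sq_abs]
        ring
    have e2 : ‖p - x‖ ≤ ‖p - y‖ + ‖y - x‖ := by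
      simpa using norm_add_le (p - y) (y - x)
    have ex := e1 x
    have ey := e1 y
    have hq : 0 ≤ z₁ * τ - τ ^ 2 / 4 := by nlinarith
    have e3 : ‖p - y‖ ≤ r := by
      refine abs_le_of_sq_le_sq' ?_ hr |>.2
      nlinarith
    have e4 : ‖p - x‖ ^ 2 ≤ (‖p - y‖ + ‖y - x‖) ^ 2 := by gcongr
    have e5 : (‖y - x‖ + r) ^ 2 ≤ R ^ 2 := by gcongr
    nlinarith [norm_nonneg (y - x), norm_nonneg (p - y)]
  unfold capKerDiff capKer
  rw [norm_reflPt_sub_sq hω, norm_reflPt_sub_sq hω, ← hx₁, ← hy₁, ← hz₁]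
  set A := r ^ 2 - ‖z - y‖ ^ 2 with hA
  set B := R ^ 2 - ‖z - x‖ ^ 2 with hB
  rw [show r ^ 2 - (‖z - y‖ ^ 2 + 4 * (y₁ * z₁)) = A - 4 * (y₁ * z₁) by ring,
    show R ^ 2 - (‖z - x‖ ^ 2 + 4 * (x₁ * z₁)) = B - 4 * (x₁ * z₁) by ring]
  have hxz : 0 < x₁ * z₁ := mul_pos hx0 hz0
  have hyz : 0 < y₁ * z₁ := mul_pos hy0 hz0
  -- The right side is `min (B₊, 4 x₁ z₁)`, that is `x₁` times the length of the admissible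
  -- `τ`-interval.
  have hlow : ∀ τ, 0 ≤ τ → τ ≤ 4 * z₁ → τ * x₁ ≤ B → τ * x₁ ≤ max B 0 - max (B - 4 * (x₁ * z₁)) 0 :=
    fun τ h0 h4 h => by
      rcases le_total (B - 4 * (x₁ * z₁)) 0 with hc | hc
      · rw [max_eq_right hc]; linarith [le_max_left B 0]
      · rw [max_eq_left hc]; nlinarith [le_max_left B 0]
  rcases le_or_gt A 0 with hA0 | hA0
  · rw [max_eq_right hA0, max_eq_right (by linarith), sub_zero, zero_mul]
    refine mul_nonneg ?_ hy0.le
    exact sub_nonneg.2 (max_le_max_right _ (by linarith))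
  · rw [max_eq_left hA0.le]
    rcases le_total (A - 4 * (y₁ * z₁)) 0 with hc | hc
    · rw [max_eq_right hc, sub_zero]
      have h1 : A / y₁ * y₁ = A := div_mul_cancel₀ _ hy0.ne'
      have h0 : 0 ≤ A / y₁ := by positivity
      have h4 : A / y₁ ≤ 4 * z₁ := by rw [div_le_iff₀ hy0]; linarith
      have := hlow _ h0 h4 (key _ h0 h4 h1.le)
      calc A * x₁ = A / y₁ * x₁ * y₁ := by field_simp
        _ ≤ _ := by gcongr
    · rw [max_eq_left hc]
      have h4 : 0 ≤ 4 * z₁ := by positivity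
      have := hlow _ h4 le_rfl (key _ h4 le_rfl (by linarith))
      calc (A - (A - 4 * (y₁ * z₁))) * x₁ = 4 * z₁ * x₁ * y₁ := by ring
        _ ≤ _ := by gcongr

theorem capKerDiff_reflPt (hω : ‖ω‖ = 1) (r : ℝ) (x z : Euc N) :
    capKerDiff ω t r x (reflPt ω t z) = -capKerDiff ω t r x z := by
  simp [capKerDiff, reflPt_reflPt hω]

theorem capKerDiff_eq_zero (hω : ‖ω‖ = 1) {r : ℝ} {x z : Euc N} (hr : 0 ≤ r)
    (hx : t ≤ ⟪x, ω⟫) (hz : t ≤ ⟪z, ω⟫) (h : r ≤ ‖z - x‖) : capKerDiff ω t r x z = 0 := by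
  have h2 : r ≤ ‖reflPt ω t z - x‖ := by
    refine h.trans (abs_le_of_sq_le_sq' ?_ (norm_nonneg _)).2
    rw [norm_reflPt_sub_sq hω]
    nlinarith [mul_nonneg (sub_nonneg.2 hx) (sub_nonneg.2 hz)]
  rw [capKerDiff, capKer_eq_zero hr h, capKer_eq_zero hr h2, sub_zero]

/-- By oddness of `w` the reflected kernel contributes the negative of the direct one, whence the
factor `2`. -/
theorem integral_mul_capKerDiff (hω : ‖ω‖ = 1) {w : Euc N → ℝ} {x : Euc N} {R : ℝ}
    (hw : ContDiff ℝ 2 w) (hΔ : ∀ z ∈ ball x R, (Δ w) z = 0)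
    (hodd : ∀ z ∈ ball x R, w (reflPt ω t z) = -w z) {r : ℝ} (hr : 0 < r) (hrR : r ≤ R) :
    ∫ z, w z * capKerDiff ω t r x z
      = 2 * (r ^ (N + 2) * w x * ∫ ζ : Euc N, capKer 1 0 ζ) := by
  have h1 := integral_mul_capKer hw hΔ hr hrR
  rw [finrank_euclideanSpace_fin] at h1
  have hcont : Continuous fun z => w (reflPt ω t z) := hw.continuous.comp continuous_reflPt
  have hi1 := integrable_mul_capKer hr.le x hw.continuous
  have hi2 := (measurePreserving_reflPt (t := t) hω).integrable_comp_of_integrable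
    (integrable_mul_capKer hr.le x hcont)
  have h2 := (measurePreserving_reflPt (t := t) hω).integral_comp
    (Homeomorph.measurableEmbedding ⟨⟨reflPt ω t, reflPt ω t, reflPt_reflPt hω, reflPt_reflPt hω⟩,
      continuous_reflPt, continuous_reflPt⟩) (fun z => w (reflPt ω t z) * capKer r x z)
  simp only [Function.comp_def, reflPt_reflPt hω] at h2 hi2
  have h3 : ∫ z, w (reflPt ω t z) * capKer r x z = - ∫ z, w z * capKer r x z := by
    rw [← integral_neg]
    refine integral_congr_ae (Eventually.of_forall fun z => ?_)
    by_cases hz : z ∈ ball x R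
    · simp [hodd z hz]
    · rw [mem_ball, dist_eq_norm, not_lt] at hz
      simp [capKer_eq_zero hr.le (hrR.trans hz)]
  simp only [capKerDiff, mul_sub]
  rw [integral_sub hi1 hi2, h2, h3, h1]
  ring

theorem integrable_mul_capKerDiff (hω : ‖ω‖ = 1) {w : Euc N → ℝ} (hw : Continuous w) {r : ℝ}
    (hr : 0 ≤ r) (x : Euc N) : Integrable fun z => w z * capKerDiff ω t r x z := by
  have hi2 := (measurePreserving_reflPt (t := t) hω).integrable_comp_of_integrable
    (integrable_mul_capKer hr x (hw.comp (continuous_reflPt (ω := ω) (t := t))))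
  simp only [Function.comp_def, reflPt_reflPt hω] at hi2
  simp only [capKerDiff, mul_sub]
  exact (integrable_mul_capKer hr x hw).sub hi2

/-- On the support of the kernels `w` and `capKerDiff` are both odd, so their product takes equal
values at mirror points; the kernel comparison then holds pointwise on both sides and is integrated.
In the exponent, `N` comes from scaling the volume and `2` from scaling the kernel. -/
theorem harnack_of_contDiff (hω : ‖ω‖ = 1) {w : Euc N → ℝ} {x y : Euc N} {r R : ℝ}
    (hw : ContDiff ℝ 2 w) (hΔ : ∀ z ∈ ball x R, (Δ w) z = 0)
    (hodd : ∀ z ∈ ball x R, w (reflPt ω t z) = -w z)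
    (hpos : ∀ z ∈ ball x R, t < ⟪z, ω⟫ → 0 ≤ w z) (hr : 0 < r)
    (hx : t < ⟪x, ω⟫) (hy : t < ⟪y, ω⟫) (hxy : ‖y - x‖ + r ≤ R) :
    w y * (⟪x, ω⟫ - t) * r ^ (N + 2) ≤ w x * (⟪y, ω⟫ - t) * R ^ (N + 2) := by
  have hrR : r ≤ R := by linarith [norm_nonneg (y - x)]
  have hsub : ball y r ⊆ ball x R := ball_subset_ball' (by rw [dist_eq_norm]; linarith)
  have h1 := integral_mul_capKerDiff hω hw (fun z hz => hΔ z (hsub hz))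
    (fun z hz => hodd z (hsub hz)) hr le_rfl
  have h2 := integral_mul_capKerDiff hω hw hΔ hodd (hr.trans_le hrR) le_rfl
  have hpt : ∀ z, t < ⟪z, ω⟫ → w z * capKerDiff ω t r y z * (⟪x, ω⟫ - t)
      ≤ w z * capKerDiff ω t R x z * (⟪y, ω⟫ - t) ∧ w (reflPt ω t z) *
        capKerDiff ω t r y (reflPt ω t z) * (⟪x, ω⟫ - t)
      ≤ w (reflPt ω t z) * capKerDiff ω t R x (reflPt ω t z) * (⟪y, ω⟫ - t) := fun z hz => by
    simp only [capKerDiff_reflPt hω]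
    by_cases hzb : z ∈ ball x R
    · have := mul_le_mul_of_nonneg_left (capKerDiff_mul_le hω hr.le hx hy hz hxy) (hpos z hzb hz)
      rw [hodd z hzb]
      constructor <;> linarith
    · have hzb' : R ≤ ‖z - x‖ := by simpa [dist_eq_norm] using hzb
      have : r ≤ ‖z - y‖ := by
        by_contra! h
        exact hzb (hsub (by simpa [dist_eq_norm] using h))
      rw [capKerDiff_eq_zero hω hr.le hy.le hz.le this,
        capKerDiff_eq_zero hω (hr.le.trans hrR) hx.le hz.le hzb']
      simp
  have hle : ∫ z, w z * capKerDiff ω t r y z * (⟪x, ω⟫ - t)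
      ≤ ∫ z, w z * capKerDiff ω t R x z * (⟪y, ω⟫ - t) := by
    refine integral_mono ((integrable_mul_capKerDiff hω hw.continuous hr.le y).mul_const _)
      ((integrable_mul_capKerDiff hω hw.continuous (hr.le.trans hrR) x).mul_const _) fun z => ?_
    rcases lt_trichotomy t ⟪z, ω⟫ with hz | hz | hz
    · exact (hpt z hz).1
    · simp [capKerDiff, reflPt_eq_self hz.symm]
    · have := (hpt (reflPt ω t z) (by rw [inner_reflPt hω]; linarith)).2
      rwa [reflPt_reflPt hω] at this
  rw [integral_mul_const, integral_mul_const, h1, h2] at hle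
  have hc := integral_capKer_pos (E := Euc N)
  nlinarith

end Reflection

/-! ### Harnack inequalities for the quotient by the distance to the plane. -/

section Harnack

variable {N : ℕ} {ω : Euc N} {t : ℝ}

/-- `w` is harmonic in the open set `D`, which is symmetric about the hyperplane `{x | x·ω = t}`,
odd with respect to this hyperplane, and nonnegative on the side `{x | x·ω > t}`. -/
structure IsOddHarmonic (ω : Euc N) (t : ℝ) (D : Set (Euc N)) (w : Euc N → ℝ) : Prop where
  isOpen : IsOpen D
  symm : ∀ z ∈ D, reflPt ω t z ∈ D
  contDiffOn : ContDiffOn ℝ 2 w D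
  harmonic : ∀ z ∈ D, (Δ w) z = 0
  odd : ∀ z ∈ D, w (reflPt ω t z) = -w z
  nonneg : ∀ z ∈ D, t < ⟪z, ω⟫ → 0 ≤ w z

/-- The quotient of `w` by the distance to the hyperplane `{x | x·ω = t}`. -/
def planeQuot (ω : Euc N) (t : ℝ) (w : Euc N → ℝ) (x : Euc N) : ℝ := w x / (⟪x, ω⟫ - t)

variable {D : Set (Euc N)} {w : Euc N → ℝ}

theorem IsOddHarmonic.planeQuot_nonneg (h : IsOddHarmonic ω t D w) {x : Euc N} (hx : x ∈ D)
    (hxt : t < ⟪x, ω⟫) : 0 ≤ planeQuot ω t w x :=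
  div_nonneg (h.nonneg x hx hxt) (sub_nonneg.2 hxt.le)

/-- Harnack inequality for `planeQuot`, which is harmonic in dimension `N + 2` and regular up to the
hyperplane: the upper bound in terms of the value at the centre of the ball. -/
theorem IsOddHarmonic.planeQuot_le (hω : ‖ω‖ = 1) (h : IsOddHarmonic ω t D w) {x y : Euc N}
    {R : ℝ} (hxD : ball x R ⊆ D) (hx : t < ⟪x, ω⟫) (hy : t < ⟪y, ω⟫) (hxy : dist y x < R) :
    planeQuot ω t w y * (R - dist y x) ^ (N + 2) ≤ planeQuot ω t w x * R ^ (N + 2) := by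
  have hx0 : 0 < ⟪x, ω⟫ - t := sub_pos.2 hx
  have hy0 : 0 < ⟪y, ω⟫ - t := sub_pos.2 hy
  suffices hmain : w y * (⟪x, ω⟫ - t) * (R - dist y x) ^ (N + 2)
      ≤ w x * (⟪y, ω⟫ - t) * R ^ (N + 2) by
    unfold planeQuot
    rw [div_mul_eq_mul_div, div_mul_eq_mul_div, div_le_div_iff₀ hy0 hx0]
    linarith
  -- Shrinking the ball makes its closure, with its mirror image, a compact subset of `D`, so that a
  -- global `C²` extension exists.
  have hlim : ∀ᶠ R' in 𝓝[<] R, w y * (⟪x, ω⟫ - t) * (R' - dist y x) ^ (N + 2)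
      ≤ w x * (⟪y, ω⟫ - t) * R' ^ (N + 2) := by
    filter_upwards [Ioo_mem_nhdsLT hxy] with R' hR'
    set K := closedBall x R' ∪ reflPt ω t '' closedBall x R' with hK
    have hsub : closedBall x R' ⊆ D := (closedBall_subset_ball hR'.2).trans hxD
    have hKD : K ⊆ D := by
      rintro z (hz | ⟨z, hz, rfl⟩)
      · exact hsub hz
      · exact h.symm z (hsub hz)
    obtain ⟨v, hv, hvw⟩ := exists_contDiff_eqOn ((isCompact_closedBall x R').union
      ((isCompact_closedBall x R').image continuous_reflPt)) h.isOpen hKD h.contDiffOn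
    have hb : ∀ z ∈ ball x R', z ∈ K := fun z hz => Or.inl (ball_subset_closedBall hz)
    have hR0 : 0 ≤ R' := dist_nonneg.trans hR'.1.le
    have := harnack_of_contDiff (t := t) (x := x) (y := y) (r := R' - dist y x) (R := R') hω hv
      (fun z hz => ?_) (fun z hz => ?_) (fun z hz hzt => ?_) (sub_pos.2 hR'.1) hx hy
      (by rw [dist_eq_norm]; linarith)
    · rwa [hvw (Or.inl (by simpa using hR'.1.le)), hvw (Or.inl (by simpa using hR0))] at this
    · have he : v =ᶠ[𝓝 z] w := by
        filter_upwards [isOpen_ball.mem_nhds hz] with y hy using hvw (hb y hy)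
      rw [(InnerProductSpace.laplacian_congr_nhds he).self_of_nhds]
      exact h.harmonic z (hKD (hb z hz))
    · rw [hvw (hb z hz), hvw (Or.inr ⟨z, ball_subset_closedBall hz, rfl⟩)]
      exact h.odd z (hKD (hb z hz))
    · rw [hvw (hb z hz)]
      exact h.nonneg z (hKD (hb z hz)) hzt
  refine le_of_tendsto_of_tendsto ?_ ?_ hlim
  · exact ((by fun_prop : Continuous fun R' => w y * (⟪x, ω⟫ - t) *
      (R' - dist y x) ^ (N + 2)).tendsto R).mono_left nhdsWithin_le_nhds
  · exact ((by fun_prop : Continuous fun R' => w x * (⟪y, ω⟫ - t) *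
      R' ^ (N + 2)).tendsto R).mono_left nhdsWithin_le_nhds

/-- Harnack inequality for `planeQuot`: the lower bound in terms of the value at the centre. -/
theorem IsOddHarmonic.le_planeQuot (hω : ‖ω‖ = 1) (h : IsOddHarmonic ω t D w) {x y : Euc N}
    {R : ℝ} (hxD : ball x R ⊆ D) (hx : t < ⟪x, ω⟫) (hy : t < ⟪y, ω⟫) (hxy : dist y x < R) :
    planeQuot ω t w x * (R - dist y x) ^ (N + 2) ≤ planeQuot ω t w y * R ^ (N + 2) := by
  set s := dist y x with hs
  have hs0 : 0 ≤ s := dist_nonneg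
  -- The lower bound follows from the upper one. Divide the segment into `k` pieces of length `δ`
  -- and apply the upper bound about each `p (j + 1)`, in the ball of radius `R - (j + 1)δ` that
  -- still fits into `ball x R`. The factors telescope, and the excess `δ` disappears as `k → ∞`.
  have hstep : ∀ k : ℕ, 0 < k → s + s / k < R →
      planeQuot ω t w x * (R - s - s / k) ^ (N + 2)
        ≤ planeQuot ω t w y * (R - s / k) ^ (N + 2) := fun k hk hkR => by
    have hk0 : (0 : ℝ) < k := by exact_mod_cast hk
    set δ := s / k with hδ
    have hδ0 : 0 ≤ δ := by positivity
    have hkδ : k * δ = s := by rw [hδ]; field_simp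
    set p : ℕ → Euc N := fun j => AffineMap.lineMap x y ((j : ℝ) / k) with hp
    have hdist : ∀ j, dist (p j) (p (j + 1)) = δ := fun j => by
      rw [hp, dist_lineMap_lineMap, Real.dist_eq, dist_comm x y, ← hs, Nat.cast_succ,
        ← sub_div, sub_add_cancel_left, abs_div, abs_neg, abs_one, abs_of_pos hk0]
      ring
    have hdist0 : ∀ j, dist (p j) x = j * δ := fun j => by
      rw [hp, dist_lineMap_left, Real.norm_eq_abs, abs_of_nonneg (by positivity), dist_comm x y,
        ← hs, hδ]
      ring
    have hpt : ∀ j ≤ k, t < ⟪p j, ω⟫ := fun j hj => by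
      have hc : Convex ℝ {z : Euc N | t < ⟪z, ω⟫} :=
        convex_halfSpace_gt ⟨fun a b => inner_add_left a b ω, fun c a => by
          simp [inner_smul_left]⟩ t
      exact hc.lineMap_mem hx hy ⟨by positivity, div_le_one_of_le₀ (by exact_mod_cast hj) hk0.le⟩
    have hind : ∀ j ≤ k, planeQuot ω t w x * (R - (j + 1) * δ) ^ (N + 2)
        ≤ planeQuot ω t w (p j) * (R - δ) ^ (N + 2) := by
      intro j
      induction j with
      | zero => intro _; simp [hp]
      | succ j ih =>
        intro hj
        have hjk : ((j + 1 : ℕ) : ℝ) ≤ k := by exact_mod_cast hj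
        have hjδ : ((j : ℝ) + 1) * δ ≤ s := by
          rw [← hkδ]; push_cast at hjk; gcongr
        have h1 := ih (Nat.le_of_succ_le hj)
        have h2 := h.planeQuot_le hω (x := p (j + 1)) (y := p j) (R := R - (j + 1) * δ)
          (fun z hz => hxD ?_) (hpt _ hj) (hpt _ (Nat.le_of_succ_le hj))
          (by rw [hdist]; nlinarith)
        · rw [hdist] at h2
          have hA : 0 < (R - (j + 1) * δ) ^ (N + 2) := by
            apply pow_pos; nlinarith
          have hB : 0 ≤ (R - (j + 1) * δ - δ) ^ (N + 2) := by
            apply pow_nonneg; nlinarith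
          have hC : 0 ≤ (R - δ) ^ (N + 2) := by
            apply pow_nonneg; nlinarith
          push_cast
          rw [show R - ((j : ℝ) + 1 + 1) * δ = R - (j + 1) * δ - δ by ring]
          refine le_of_mul_le_mul_right ?_ hA
          nlinarith [mul_le_mul_of_nonneg_right h1 hB, mul_le_mul_of_nonneg_right h2 hC]
        · rw [mem_ball] at hz ⊢
          have := dist_triangle z (p (j + 1)) x
          rw [hdist0] at this
          push_cast at this
          linarith
    have := hind k le_rfl
    have hpk : p k = y := by simp [hp, hk0.ne']
    rw [hpk, add_mul, hkδ, one_mul] at this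
    rwa [sub_sub]
  have hlim : Tendsto (fun k : ℕ => s / (k : ℝ)) atTop (𝓝 0) := tendsto_const_div_atTop_nhds_zero_nat s
  have h1 : Tendsto (fun k : ℕ => planeQuot ω t w x * (R - s - s / k) ^ (N + 2)) atTop
      (𝓝 (planeQuot ω t w x * (R - s - 0) ^ (N + 2))) :=
    ((hlim.const_sub _).pow _).const_mul _
  have h2 : Tendsto (fun k : ℕ => planeQuot ω t w y * (R - s / k) ^ (N + 2)) atTop
      (𝓝 (planeQuot ω t w y * (R - 0) ^ (N + 2))) :=
    ((hlim.const_sub _).pow _).const_mul _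
  rw [sub_zero] at h1 h2
  refine le_of_tendsto_of_tendsto h1 h2 ?_
  have h3 : Tendsto (fun k : ℕ => s + s / (k : ℝ)) atTop (𝓝 (s + 0)) := hlim.const_add s
  rw [add_zero] at h3
  filter_upwards [eventually_gt_atTop 0, h3.eventually (gt_mem_nhds hxy)] with k hk hkR
  exact hstep k hk hkR

/-- Passing through the midpoint, with the lower bound about `x` and the upper bound about `y`,
allows steps of length up to nearly `2R`; each half costs `(1 - s)⁻¹` to the power `N + 2`. -/
theorem IsOddHarmonic.planeQuot_le_of_dist_le (hω : ‖ω‖ = 1) (h : IsOddHarmonic ω t D w)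
    {x y : Euc N} {R s : ℝ} (hR : 0 < R) (hxD : ball x R ⊆ D) (hyD : ball y R ⊆ D)
    (hx : t < ⟪x, ω⟫) (hy : t < ⟪y, ω⟫) (hs : s < 1) (hxy : dist x y ≤ 2 * s * R) :
    planeQuot ω t w x ≤ ((1 - s)⁻¹ ^ 2) ^ (N + 2) * planeQuot ω t w y := by
  set z := midpoint ℝ x y with hz
  have hzt : t < ⟪z, ω⟫ := by
    rw [hz, midpoint_eq_smul_add, inner_smul_left, inner_add_left]
    simp; linarith
  have hdx : dist z x ≤ s * R := by
    rw [hz, dist_midpoint_left]; simp; linarith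
  have hdy : dist z y ≤ s * R := by
    rw [hz, dist_midpoint_right]; simp; linarith
  have hsR : s * R < R := by nlinarith
  have h1 := h.le_planeQuot hω hxD hx hzt (hdx.trans_lt hsR)
  have h2 := h.planeQuot_le hω hyD hy hzt (hdy.trans_lt hsR)
  have hx0 : 0 ≤ planeQuot ω t w x := h.planeQuot_nonneg (hxD (mem_ball_self hR)) hx
  have hz0 : 0 ≤ planeQuot ω t w z :=
    h.planeQuot_nonneg (hxD (mem_ball.2 (hdx.trans_lt hsR))) hzt
  have hpos : 0 < (1 - s) * R := mul_pos (sub_pos.2 hs) hR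
  have h1' : planeQuot ω t w x * ((1 - s) * R) ^ (N + 2) ≤ planeQuot ω t w z * R ^ (N + 2) := by
    refine le_trans ?_ h1
    gcongr; linarith
  have h2' : planeQuot ω t w z * ((1 - s) * R) ^ (N + 2) ≤ planeQuot ω t w y * R ^ (N + 2) := by
    refine le_trans ?_ h2
    gcongr; linarith
  have hR' : 0 < R ^ (N + 2) := pow_pos hR _
  have hq : 0 < (1 - s) ^ (N + 2) := pow_pos (sub_pos.2 hs) _
  rw [mul_pow, ← mul_assoc, mul_le_mul_iff_left₀ hR'] at h1' h2'
  rw [← pow_mul, mul_comm 2, pow_mul, inv_pow, inv_pow, ← div_eq_inv_mul,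
    le_div_iff₀ (by positivity)]
  nlinarith

end Harnack

/-! ### The weak minimum principle. -/

section MaximumPrinciple

variable {E : Type*} [NormedAddCommGroup E] [InnerProductSpace ℝ E] [FiniteDimensional ℝ E]

theorem laplacian_norm_sq (x : E) : (Δ fun y : E => ‖y‖ ^ 2) x = 2 * (Module.finrank ℝ E : ℝ) := by
  have h1 : fderiv ℝ (fun y : E => ‖y‖ ^ 2) = fun y => (2 : ℝ) • innerSL ℝ y := by
    ext1 y
    rw [(hasStrictFDerivAt_norm_sq y).hasFDerivAt.fderiv]
    ext v; simp
  have h2 : HasFDerivAt (fun y : E => (2 : ℝ) • innerSL ℝ y) ((2 : ℝ) • innerSL ℝ) x :=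
    (innerSL ℝ (E := E)).hasFDerivAt.const_smul (2 : ℝ)
  set b := stdOrthonormalBasis ℝ E
  rw [laplacian_eq_sum_fderiv_fderiv b, h1, h2.fderiv]
  have h3 : ∀ i, ((2 : ℝ) • innerSL ℝ (E := E)) (b i) (b i) = 2 := fun i => by
    change (2 : ℝ) * ⟪b i, b i⟫ = 2
    rw [real_inner_self_eq_norm_sq]; simp
  simp only [h3]
  simp [mul_comm]

/-- Weak minimum principle for superharmonic functions. -/
theorem nonneg_of_laplacian_nonpos [Nontrivial E] {U : Set E} (hU : IsOpen U)
    (hUb : Bornology.IsBounded U) {f : E → ℝ} (hf : ContDiffOn ℝ 2 f U)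
    (hfc : ContinuousOn f (closure U)) (hΔ : ∀ x ∈ U, (Δ f) x ≤ 0)
    (hfr : ∀ x ∈ frontier U, 0 ≤ f x) : ∀ x ∈ U, 0 ≤ f x := by
  intro x hx
  obtain ⟨B, hB⟩ := hUb.closure.exists_norm_le
  have hcomp : IsCompact (closure U) := hUb.isCompact_closure
  -- Subtracting `ε‖y‖²` makes the Laplacian strictly negative, which excludes an interior minimum.
  have hmain : ∀ ε > 0, -(ε * B ^ 2) ≤ f x := fun ε hε => by
    have hgc : ContinuousOn (fun y => f y - ε * ‖y‖ ^ 2) (closure U) :=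
      hfc.sub (by fun_prop)
    obtain ⟨y, hy, hmin⟩ := hcomp.exists_isMinOn ⟨x, subset_closure hx⟩ hgc
    have hyU : y ∉ U := fun hyU => by
      have hyf := hf.contDiffAt (hU.mem_nhds hyU)
      have hn : ContDiffAt ℝ 2 (fun y : E => ‖y‖ ^ 2) y := (contDiff_norm_sq ℝ).contDiffAt
      have hnε : ContDiffAt ℝ 2 (ε • fun y : E => ‖y‖ ^ 2) y := hn.const_smul ε
      have heq : (fun y => f y - ε * ‖y‖ ^ 2) = f - ε • fun y : E => ‖y‖ ^ 2 := by
        ext y; simp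
      have h1 := laplacian_nonneg_of_isLocalMin (f := fun y => f y - ε * ‖y‖ ^ 2)
        (by rw [heq]; exact hyf.sub hnε)
        (hmin.isLocalMin (mem_of_superset (hU.mem_nhds hyU) subset_closure))
      rw [heq, hyf.laplacian_sub hnε, InnerProductSpace.laplacian_smul _ hn, laplacian_norm_sq] at h1
      have h2 := hΔ y hyU
      have h3 : (0 : ℝ) < Module.finrank ℝ E := by exact_mod_cast Module.finrank_pos
      have h4 : 0 < ε * (2 * Module.finrank ℝ E) := by positivity
      simp only [smul_eq_mul] at h1
      linarith
    have h1 : f y - ε * ‖y‖ ^ 2 ≤ f x - ε * ‖x‖ ^ 2 := hmin (subset_closure hx)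
    have h2 := hfr y ⟨hy, by rwa [hU.interior_eq]⟩
    have h3 : ‖y‖ ^ 2 ≤ B ^ 2 := by gcongr; exact hB y hy
    have h4 : 0 ≤ ε * ‖x‖ ^ 2 := by positivity
    nlinarith
  have hlim : Tendsto (fun ε : ℝ => -(ε * B ^ 2)) (𝓝[>] 0) (𝓝 0) := by
    have : Continuous fun ε : ℝ => -(ε * B ^ 2) := by fun_prop
    simpa using (this.tendsto 0).mono_left nhdsWithin_le_nhds
  exact le_of_tendsto hlim (eventually_mem_nhdsWithin.mono hmain)

end MaximumPrinciple

/-! ### The reflected difference as an odd harmonic function. -/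

section Reflection

variable {N : ℕ} {ω : Euc N} {t R : ℝ} {G : Set (Euc N)} {u : Euc N → ℝ}

/-- The points of the parallel set `G + B_R` whose reflections belong to this set. -/
def symmDomain (G : Set (Euc N)) (R : ℝ) (ω : Euc N) (t : ℝ) : Set (Euc N) :=
  {z | z ∈ thickening R G ∧ reflPt ω t z ∈ thickening R G}

theorem ball_subset_thickening_of_mem_closure {x : Euc N} (hx : x ∈ closure G) :
    ball x R ⊆ thickening R G := by
  rw [← thickening_closure]
  exact ball_subset_thickening hx R

/-- A nearby point of `G` on the right is reflected along with `z`; one on the left can be kept,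
since reflecting `z` brings it closer. -/
theorem reflPt_mem_thickening (hω : ‖ω‖ = 1) (hG : reflCap G ω t ⊆ G) {z : Euc N}
    (hz : z ∈ thickening R G) (hzt : t ≤ ⟪z, ω⟫) : reflPt ω t z ∈ thickening R G := by
  rw [mem_thickening_iff] at hz ⊢
  obtain ⟨g, hg, hzg⟩ := hz
  by_cases hgt : t < ⟪g, ω⟫
  · refine ⟨reflPt ω t g, hG ?_, by rwa [dist_reflPt_reflPt hω]⟩
    rw [reflCap, mem_ofPred, reflPt_reflPt hω]
    exact ⟨hg, hgt⟩
  · refine ⟨g, hg, lt_of_le_of_lt ?_ hzg⟩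
    rw [dist_eq_norm, dist_eq_norm]
    refine (abs_le_of_sq_le_sq' ?_ (norm_nonneg _)).2
    rw [norm_reflPt_sub_sq hω]
    nlinarith [mul_nonneg (sub_nonneg.2 (not_lt.1 hgt)) (sub_nonneg.2 hzt)]

/-- Points of the ball left of the plane move closer to the centre when reflected. This is why full
balls crossing the plane are available to the Harnack inequality. -/
theorem ball_subset_symmDomain (hω : ‖ω‖ = 1) (hG : reflCap G ω t ⊆ G) {x : Euc N} {r : ℝ}
    (hxt : t ≤ ⟪x, ω⟫) (hx : ball x r ⊆ thickening R G) : ball x r ⊆ symmDomain G R ω t := by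
  intro z hz
  refine ⟨hx hz, ?_⟩
  rcases le_total t ⟪z, ω⟫ with hzt | hzt
  · exact reflPt_mem_thickening hω hG (hx hz) hzt
  · refine hx ?_
    rw [mem_ball, dist_eq_norm] at hz ⊢
    refine lt_of_le_of_lt (abs_le_of_sq_le_sq' ?_ (norm_nonneg _)).2 hz
    rw [norm_reflPt_sub_sq hω]
    nlinarith [mul_nonneg (sub_nonneg.2 hzt) (sub_nonneg.2 hxt)]

theorem isOpen_symmDomain : IsOpen (symmDomain G R ω t) := by
  have h : symmDomain G R ω t = thickening R G ∩ reflPt ω t ⁻¹' thickening R G := rfl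
  rw [h]
  exact isOpen_thickening.inter (isOpen_thickening.preimage continuous_reflPt)

theorem IsTorsionSolution.nonneg [Nontrivial (Euc N)] (hGb : Bornology.IsBounded G)
    (hu : IsTorsionSolution (thickening R G) u) : ∀ x ∈ closure (thickening R G), 0 ≤ u x := by
  have h := nonneg_of_laplacian_nonpos isOpen_thickening hGb.thickening hu.contDiffOn
    hu.continuousOn (fun x hx => by linarith [hu.eqn x hx]) fun x hx => (hu.boundary x hx).ge
  intro x hx
  by_cases hxΩ : x ∈ thickening R G
  · exact h x hxΩ
  · exact (hu.boundary x ⟨hx, by rwa [isOpen_thickening.interior_eq]⟩).ge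

theorem IsTorsionSolution.isOddHarmonic [Nontrivial (Euc N)] (hω : ‖ω‖ = 1)
    (hGb : Bornology.IsBounded G) (hG : reflCap G ω t ⊆ G)
    (hu : IsTorsionSolution (thickening R G) u) :
    IsOddHarmonic ω t (symmDomain G R ω t) fun x => u (reflPt ω t x) - u x := by
  have hΩ : IsOpen (thickening R G) := isOpen_thickening
  have hud : ∀ z ∈ thickening R G, ContDiffAt ℝ 2 u z := fun z hz =>
    hu.contDiffOn.contDiffAt (hΩ.mem_nhds hz)
  have hσ : ContDiff ℝ 2 (reflPt ω t) :=
    contDiff_id.sub ((contDiff_const.mul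
      ((contDiff_id.inner ℝ contDiff_const).sub contDiff_const)).smul contDiff_const)
  have hσd : ∀ z, reflPt ω t z ∈ thickening R G →
      ContDiffAt ℝ 2 (fun x => u (reflPt ω t x)) z := fun z hz =>
    (hud _ hz).comp z hσ.contDiffAt
  have hC : ContDiffOn ℝ 2 (fun x => u (reflPt ω t x) - u x) (symmDomain G R ω t) :=
    fun z hz => ((hσd z hz.2).sub (hud z hz.1)).contDiffWithinAt
  have hharm : ∀ z ∈ symmDomain G R ω t, (Δ fun x => u (reflPt ω t x) - u x) z = 0 :=
    fun z hz => by
      have := (hσd z hz.2).laplacian_sub (hud z hz.1)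
      rw [laplacian_comp_reflPt hω (hud _ hz.2)] at this
      have h1 := hu.eqn _ hz.1
      have h2 := hu.eqn _ hz.2
      change (Δ ((fun x => u (reflPt ω t x)) - u)) z = 0
      rw [this]; linarith
  refine ⟨isOpen_symmDomain, fun z hz => ⟨hz.2, by rw [reflPt_reflPt hω]; exact hz.1⟩, hC, hharm,
    fun z _ => by simp [reflPt_reflPt hω], ?_⟩
  -- Nonnegativity is the minimum principle on the right half of the parallel set: on the plane the
  -- difference vanishes, and on the outer boundary it equals `u` at the mirror point, which is
  -- nonnegative.
  set U := thickening R G ∩ {z | t < ⟪z, ω⟫} with hUdef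
  have hUo : IsOpen U := hΩ.inter (isOpen_lt continuous_const (by fun_prop))
  have hUD : U ⊆ symmDomain G R ω t := fun z hz =>
    ⟨hz.1, reflPt_mem_thickening hω hG hz.1 (le_of_lt hz.2)⟩
  have hcl : closure U ⊆ closure (thickening R G) := closure_mono inter_subset_left
  have hcl' : ∀ z ∈ closure U, reflPt ω t z ∈ closure (thickening R G) := fun z hz =>
    map_mem_closure continuous_reflPt hz fun y hy => (hUD hy).2
  have hcl'' : ∀ z ∈ closure U, t ≤ ⟪z, ω⟫ := fun z hz =>
    closure_minimal (fun y hy => le_of_lt hy.2)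
      (isClosed_le continuous_const (by fun_prop : Continuous fun z : Euc N => ⟪z, ω⟫)) hz
  have hnn := hu.nonneg hGb
  have key := nonneg_of_laplacian_nonpos hUo (hGb.thickening.subset inter_subset_left)
    (hC.mono hUD) ((hu.continuousOn.comp continuous_reflPt.continuousOn hcl').sub
      (hu.continuousOn.mono hcl)) (fun z hz => (hharm z (hUD hz)).le) fun z hz => ?_
  · exact fun z hz hzt => key z ⟨hz.1, hzt⟩
  · have hzc := frontier_subset_closure hz
    by_cases hzΩ : z ∈ thickening R G
    · have hzt : ¬ t < ⟪z, ω⟫ := fun h => by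
        rw [hUo.frontier_eq] at hz
        exact hz.2 ⟨hzΩ, h⟩
      have := reflPt_eq_self (le_antisymm (not_lt.1 hzt) (hcl'' z hzc))
      simp [this]
    · rw [hu.boundary z ⟨hcl hzc, by rwa [hΩ.interior_eq]⟩, sub_zero]
      exact hnn _ (hcl' z hzc)

end Reflection

/-! ### Harnack chains along paths. -/

section Chain

/-- A Harnack chain along a path, built from the last exits from balls of radius `ε`: its length is
bounded by the number of `ε`-separated points in `S`. -/
theorem exists_pow_mul_le_of_joinedIn {X : Type*} [PseudoMetricSpace X] {S : Set X} {f : X → ℝ}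
    {ε A K : ℝ} (hε : 0 < ε) (hA : 0 ≤ A)
    (hstep : ∀ a ∈ S, ∀ b ∈ S, dist a b ≤ ε → f a ≤ A * f b)
    (hpack : ∀ T : Finset X, (T : Set X) ⊆ S → (T : Set X).Pairwise (fun p q => ε ≤ dist p q) →
      (T.card : ℝ) ≤ K) {x y : X} (hxy : JoinedIn S x y) :
    ∃ k : ℕ, (k : ℝ) ≤ K ∧ f x ≤ A ^ k * f y := by
  classical
  obtain ⟨γ, hγ⟩ := hxy
  by_contra! hcon
  -- The set `T` holds the first `k` centres, and from time `t` on the path keeps distance `ε` from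
  -- all of them. If the desired bound failed, the construction would never stop, contradicting the
  -- packing bound.
  have hstate : ∀ k : ℕ, ∃ (t : unitInterval) (T : Finset X), T.card = k ∧ (T : Set X) ⊆ S ∧
      (T : Set X).Pairwise (fun p q => ε ≤ dist p q) ∧
      (∀ p ∈ T, ∀ s ≥ t, ε ≤ dist p (γ s)) ∧ f x ≤ A ^ k * f (γ t) := by
    intro k
    induction k with
    | zero => exact ⟨0, ∅, by simp⟩
    | succ k ih =>
      obtain ⟨t, T, hTk, hTS, hTp, hTt, hf⟩ := ih
      have hBc : IsCompact {s : unitInterval | t ≤ s ∧ dist (γ t) (γ s) ≤ ε} :=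
        (isClosed_Ici.inter (isClosed_le (f := fun s => dist (γ t) (γ s)) (by fun_prop)
          continuous_const)).isCompact
      obtain ⟨t', ⟨htt', ht'd⟩, ht'max⟩ := hBc.exists_isGreatest ⟨t, le_rfl, by simp [hε.le]⟩
      have hnot : γ t ∉ T := fun h => by
        have := hTt _ h t le_rfl
        rw [dist_self] at this
        linarith
      have hcard : (insert (γ t) T).card = k + 1 := by rw [Finset.card_insert_of_notMem hnot, hTk]
      have hS : ((insert (γ t) T : Finset X) : Set X) ⊆ S := by
        rw [Finset.coe_insert]
        exact insert_subset (hγ t) hTS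
      have hP : ((insert (γ t) T : Finset X) : Set X).Pairwise (fun p q => ε ≤ dist p q) := by
        rw [Finset.coe_insert]
        refine hTp.insert fun b hb _ => ⟨?_, hTt b hb t le_rfl⟩
        rw [dist_comm]; exact hTt b hb t le_rfl
      have hfle : f x ≤ A ^ (k + 1) * f (γ t') := by
        rw [pow_succ, mul_assoc]
        exact hf.trans (mul_le_mul_of_nonneg_left (hstep _ (hγ t) _ (hγ t') ht'd) (pow_nonneg hA k))
      -- A last exit at time `1` would end the chain at `y` after `k + 1` steps, a number the
      -- packing bound allows.
      have ht'1 : t' < 1 := by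
        refine lt_of_le_of_ne unitInterval.le_one' fun h => ?_
        have hK := hpack _ hS hP
        rw [hcard] at hK
        rw [h, γ.target] at hfle
        exact (hcon (k + 1) hK).not_ge hfle
      refine ⟨t', insert (γ t) T, hcard, hS, hP, fun p hp s hs => ?_, hfle⟩
      rcases Finset.mem_insert.1 hp with rfl | hp
      · have hgt : ∀ s > t', ε ≤ dist (γ t) (γ s) := fun s hs => by
          by_contra! h
          exact hs.not_ge (ht'max ⟨htt'.trans hs.le, h.le⟩)
        rcases hs.lt_or_eq with hs | hs
        · exact hgt s hs
        · rw [← hs]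
          have : (𝓝[>] t').NeBot := nhdsGT_neBot_of_exists_gt ⟨1, ht'1⟩
          refine ge_of_tendsto (f := fun s => dist (γ t) (γ s)) (x := 𝓝[>] t') ?_
            (eventually_mem_nhdsWithin.mono hgt)
          exact ((by fun_prop : Continuous fun s => dist (γ t) (γ s)).tendsto t').mono_left
            nhdsWithin_le_nhds
      · exact hTt p hp s (htt'.trans hs)
  obtain ⟨k, hk⟩ := exists_nat_gt K
  obtain ⟨-, T, hTk, hTS, hTp, -⟩ := hstate k
  have := hpack T hTS hTp
  rw [hTk] at this
  linarith

end Chain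

/-! ### Volume bounds for separated sets. -/

section Packing

variable {N : ℕ}

theorem card_mul_volume_le {T : Finset (Euc N)} {ε : ℝ} {W : Set (Euc N)}
    (hT : (T : Set (Euc N)).Pairwise fun p q => ε ≤ dist p q)
    (hW : ∀ p ∈ T, ball p (ε / 2) ⊆ W) :
    (T.card : ENNReal) * volume (ball (0 : Euc N) (ε / 2)) ≤ volume W := by
  have hdisj : (T : Set (Euc N)).PairwiseDisjoint fun p => ball p (ε / 2) := fun p hp q hq hpq =>
    ball_disjoint_ball (by linarith [hT hp hq hpq])
  calc (T.card : ENNReal) * volume (ball (0 : Euc N) (ε / 2))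
      = ∑ p ∈ T, volume (ball p (ε / 2)) := by
        simp [Measure.addHaar_ball_center]
    _ = volume (⋃ p ∈ T, ball p (ε / 2)) :=
        (measure_biUnion_finset hdisj fun p _ => measurableSet_ball).symm
    _ ≤ volume W := measure_mono (iUnion₂_subset hW)

theorem card_le_of_dist_le {T : Finset (Euc N)} {ε d : ℝ} (hε : 0 < ε) (hd : 0 ≤ d)
    (hT : (T : Set (Euc N)).Pairwise fun p q => ε ≤ dist p q)
    (hTd : ∀ p ∈ T, ∀ q ∈ T, dist p q ≤ d) : (T.card : ℝ) * (ε / 2) ^ N ≤ (d + ε / 2) ^ N := by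
  rcases T.eq_empty_or_nonempty with rfl | ⟨q, hq⟩
  · simp; positivity
  have h := card_mul_volume_le hT (W := ball q (d + ε / 2)) fun p hp =>
    ball_subset_ball' (by linarith [hTd p hp q hq])
  rw [Measure.addHaar_ball_of_pos _ _ (r := ε / 2) (by positivity),
    Measure.addHaar_ball_of_pos _ _ (r := d + ε / 2) (by positivity), ← mul_assoc, ENNReal.mul_le_mul_iff_left (measure_ball_pos _ _ one_pos).ne'
      measure_ball_lt_top.ne, finrank_euclideanSpace_fin, ← ENNReal.ofReal_natCast,
    ← ENNReal.ofReal_mul (by positivity), ENNReal.ofReal_le_ofReal_iff (by positivity)] at h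
  exact h

theorem volume_box (b : OrthonormalBasis (Fin N) ℝ (Euc N)) (l h : Fin N → ℝ) :
    volume {z : Euc N | ∀ i, ⟪b i, z⟫ ∈ Icc (l i) (h i)} = ∏ i, ENNReal.ofReal (h i - l i) := by
  have h1 : MeasurePreserving (fun z : Euc N => WithLp.ofLp (b.repr z)) volume volume :=
    (PiLp.volume_preserving_ofLp (Fin N)).comp b.measurePreserving_repr
  have h2 : {z : Euc N | ∀ i, ⟪b i, z⟫ ∈ Icc (l i) (h i)}
      = (fun z : Euc N => WithLp.ofLp (b.repr z)) ⁻¹' (Icc l h) := by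
    ext z
    simp only [mem_ofPred, mem_preimage, mem_Icc, Pi.le_def, b.repr_apply_apply, forall_and]
  rw [h2, h1.measure_preimage measurableSet_Icc.nullMeasurableSet, Real.volume_Icc_pi]

/-- The enlarged points lie in a box with one side parallel to `ω`; that side is `d/2 + R` rather
than `d + R`, which is where the factor `1/2` is gained. -/
theorem card_le_of_slab {ω : Euc N} (hω : ‖ω‖ = 1) {t R d : ℝ} (hR : 0 < R) (hd : 0 ≤ d)
    {T : Finset (Euc N)} (hT : (T : Set (Euc N)).Pairwise fun p q => R ≤ dist p q)
    (hTd : ∀ p ∈ T, ∀ q ∈ T, dist p q ≤ d)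
    (hTt : ∀ p ∈ T, t ≤ ⟪p, ω⟫ ∧ ⟪p, ω⟫ ≤ t + d / 2) :
    (T.card : ℝ) * volume.real (ball (0 : Euc N) 1) ≤ 2 ^ N / 2 * (2 + d / R) ^ N := by
  rcases T.eq_empty_or_nonempty with rfl | hne
  · simp; positivity
  have hN : 0 < N := by
    rcases Nat.eq_zero_or_pos N with rfl | h
    · rw [Subsingleton.elim ω 0] at hω; simp at hω
    · exact h
  set i₀ : Fin N := ⟨0, hN⟩
  obtain ⟨b, hb⟩ := Orthonormal.exists_orthonormalBasis_extension_of_card_eq (𝕜 := ℝ)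
    (E := Euc N) (ι := Fin N) (by simp) (v := fun _ => ω) (s := {i₀})
    ⟨fun _ => hω, fun i j hij => absurd (Subsingleton.elim i j) hij⟩
  have hb0 : b i₀ = ω := hb i₀ rfl
  set len : Fin N → ℝ := fun i => if i = i₀ then d / 2 else d with hlen
  have hl : ∀ i, ∃ l : ℝ, ∀ p ∈ T, l ≤ ⟪b i, p⟫ ∧ ⟪b i, p⟫ ≤ l + len i := fun i => by
    by_cases hi : i = i₀
    · refine ⟨t, fun p hp => ?_⟩
      simp only [hlen, hi, if_true, hb0]
      rw [real_inner_comm]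
      exact hTt p hp
    · obtain ⟨q, hq, hmin⟩ := T.exists_min_image (fun p => ⟪b i, p⟫) hne
      refine ⟨⟪b i, q⟫, fun p hp => ⟨hmin p hp, ?_⟩⟩
      simp only [hlen, hi, if_false]
      have h1 : ⟪b i, p - q⟫ ≤ ‖b i‖ * ‖p - q‖ := real_inner_le_norm _ _
      rw [b.norm_eq_one, one_mul, inner_sub_right, ← dist_eq_norm] at h1
      linarith [hTd p hp q hq]
  choose l hl using hl
  have h := card_mul_volume_le hT
    (W := {z : Euc N | ∀ i, ⟪b i, z⟫ ∈ Icc (l i - R / 2) (l i + len i + R / 2)})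
    fun p hp z hz i => by
      have h1 : |⟪b i, z - p⟫| ≤ ‖b i‖ * ‖z - p‖ := abs_real_inner_le_norm _ _
      rw [b.norm_eq_one, one_mul, inner_sub_right, ← dist_eq_norm, abs_le] at h1
      have h2 := hl i p hp
      rw [mem_ball] at hz
      constructor <;> linarith
  have hlen0 : ∀ i, 0 ≤ len i := fun i => by simp only [hlen]; split_ifs <;> positivity
  have hlenR : ∀ i, l i + len i + R / 2 - (l i - R / 2) = len i + R := fun i => by ring
  have hprod : ∏ i, (len i + R) ≤ R ^ N / 2 * (2 + d / R) ^ N := by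
    have h1 : ∀ i, len i + R ≤ R * (2 + d / R) * (if i = i₀ then 1 / 2 else 1) := fun i => by
      have : R * (2 + d / R) = 2 * R + d := by field_simp
      rw [this]
      simp only [hlen]
      split_ifs <;> linarith
    calc ∏ i, (len i + R) ≤ ∏ i, R * (2 + d / R) * (if i = i₀ then 1 / 2 else 1) :=
          Finset.prod_le_prod (fun i _ => by linarith [hlen0 i]) fun i _ => h1 i
      _ = R ^ N / 2 * (2 + d / R) ^ N := by
          rw [Finset.prod_mul_distrib, Finset.prod_ite_eq' Finset.univ i₀]
          simp [mul_pow]; ring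
  rw [volume_box, Measure.addHaar_ball_of_pos _ _ (by positivity), finrank_euclideanSpace_fin] at h
  simp only [hlenR] at h
  rw [← ENNReal.ofReal_prod_of_nonneg fun i _ => by linarith [hlen0 i],
    ← ofReal_measureReal measure_ball_lt_top.ne,
    ← ENNReal.ofReal_natCast, ← ENNReal.ofReal_mul (by positivity),
    ← ENNReal.ofReal_mul (by positivity), ENNReal.ofReal_le_ofReal_iff
      (Finset.prod_nonneg fun i _ => by linarith [hlen0 i])] at h
  have h3 := h.trans hprod
  rw [div_pow] at h3
  have hRN : 0 < R ^ N := by positivity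
  rw [show (T.card : ℝ) * (R ^ N / 2 ^ N * volume.real (ball (0 : Euc N) 1))
    = R ^ N * ((T.card : ℝ) * volume.real (ball (0 : Euc N) 1) / 2 ^ N) by ring,
    show R ^ N / 2 * (2 + d / R) ^ N = R ^ N * ((2 + d / R) ^ N / 2) by ring,
    mul_le_mul_iff_right₀ hRN, div_le_iff₀ (by positivity)] at h3
  linarith

end Packing

/-! ### Comparison of chain constants with `C_N`. -/

section Numerics

/-- From `9 ≥ 8` one has `log 3 ≥ (3/2) log 2`, so `C_N` is at least `2` to the power `2^N (N -
1/2)`. -/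
theorem le_log_harnackBase (N : ℕ) :
    2 ^ N * ((N : ℝ) - 1 / 2) * Real.log 2 ≤ Real.log (harnackBase N) := by
  have h3 : 3 / 2 * Real.log 2 ≤ Real.log 3 := by
    have : Real.log (2 ^ 3) ≤ Real.log (3 ^ 2) := Real.log_le_log (by norm_num) (by norm_num)
    rw [Real.log_pow, Real.log_pow] at this
    push_cast at this
    linarith
  unfold harnackBase
  rw [Real.log_mul (by positivity) (by positivity), Real.log_pow, Real.log_zpow]
  push_cast
  have : (0 : ℝ) < 2 ^ N := by positivity
  nlinarith

theorem harnackBase_pos (N : ℕ) : 0 < harnackBase N := by unfold harnackBase; positivity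

theorem two_pow_pow_le_harnackBase_rpow {N a k : ℕ} {κ X : ℝ} (hX : 0 ≤ X) (hk : (k : ℝ) ≤ κ * X)
    (ha : a * κ ≤ 2 ^ N * ((N : ℝ) - 1 / 2)) :
    ((2 : ℝ) ^ a) ^ k ≤ harnackBase N ^ X := by
  rw [← Real.log_le_log_iff (by positivity) (Real.rpow_pos_of_pos (harnackBase_pos N) X),
    Real.log_rpow (harnackBase_pos N), Real.log_pow, Real.log_pow]
  have hl2 : 0 < Real.log 2 := Real.log_pos one_lt_two
  calc (k : ℝ) * (a * Real.log 2) ≤ κ * X * (a * Real.log 2) := by gcongr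
    _ = a * κ * (X * Real.log 2) := by ring
    _ ≤ 2 ^ N * ((N : ℝ) - 1 / 2) * (X * Real.log 2) := by gcongr
    _ = X * (2 ^ N * ((N : ℝ) - 1 / 2) * Real.log 2) := by ring
    _ ≤ X * Real.log (harnackBase N) := by gcongr; exact le_log_harnackBase N

/-- The condition under which steps of length `3R/2`, each costing `2^(4(N+2))`, with packing factor
`(4/3)^N`, are absorbed by `C_N`. -/
theorem four_mul_add_two_mul_le {N : ℕ} (hN : 5 ≤ N) :
    4 * ((N : ℝ) + 2) * (4 / 3) ^ N ≤ 2 ^ N * ((N : ℝ) - 1 / 2) := by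
  have h : 4 * ((N : ℝ) + 2) * (2 / 3) ^ N ≤ (N : ℝ) - 1 / 2 := by
    induction N, hN using Nat.le_induction with
    | base => norm_num
    | succ n hn ih =>
      have h5 : (5 : ℝ) ≤ n := by exact_mod_cast hn
      have hp : (0 : ℝ) < (2 / 3) ^ n := by positivity
      rw [pow_succ]
      push_cast
      nlinarith
  have he : (4 / 3 : ℝ) ^ N = 2 ^ N * (2 / 3) ^ N := by rw [← mul_pow]; norm_num
  rw [he]
  have : (0 : ℝ) < 2 ^ N := by positivity
  nlinarith

/-- The corresponding condition for steps of length `R`, each costing `2^(2(N+2))`, with the slab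
packing bound. -/
theorem add_two_div_le_volume_ball {N : ℕ} (h2 : 2 ≤ N) (h4 : N ≤ 4) :
    (N : ℝ) + 2 ≤ ((N : ℝ) - 1 / 2) * volume.real (ball (0 : Euc N) 1) := by
  have hπ := Real.pi_gt_three
  interval_cases N
  · have : volume.real (ball (0 : Euc 2) 1) = Real.pi := by
      rw [measureReal_def, EuclideanSpace.volume_ball_fin_two]; simp [Real.pi_nonneg]
    rw [this]; push_cast; linarith
  · have : volume.real (ball (0 : Euc 3) 1) = Real.pi * 4 / 3 := by
      rw [measureReal_def, EuclideanSpace.volume_ball_fin_three]; simp; positivity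
    rw [this]; push_cast; linarith
  · have : volume.real (ball (0 : Euc 4) 1) = Real.pi ^ 2 / 2 := by
      rw [measureReal_def, InnerProductSpace.volume_ball_of_dim_even (k := 2) (by simp)]
      simp [Nat.factorial]; positivity
    rw [this]; push_cast; nlinarith

/-- For `N = 1` the base is only `9/4`. The factor `64 = 2^6` comes from `1 + X/4 ≤ 2 exp (X/8)`,
and the remaining exponent is covered by `3/4 ≤ log (9/4)`. -/
theorem one_add_div_four_pow_six_le {X : ℝ} (hX : 0 ≤ X) :
    (1 + X / 4) ^ 6 ≤ 64 * harnackBase 1 ^ (2 + X) := by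
  have hb : harnackBase 1 = 9 / 4 := by
    unfold harnackBase
    norm_num [zpow_neg]
  have h1 : 1 + X / 4 ≤ 2 * Real.exp (X / 8) := by linarith [Real.add_one_le_exp (X / 8)]
  have h2 : (1 + X / 4) ^ 6 ≤ 64 * Real.exp (3 / 4 * X) := by
    calc (1 + X / 4) ^ 6 ≤ (2 * Real.exp (X / 8)) ^ 6 := by gcongr
      _ = 64 * Real.exp (3 / 4 * X) := by
        rw [mul_pow, ← Real.exp_nat_mul]; push_cast; ring_nf
  have h3 : 3 / 4 ≤ Real.log (9 / 4) := by
    rw [Real.le_log_iff_exp_le (by norm_num)]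
    have h4 : Real.exp (3 / 4) ^ 4 = Real.exp 1 ^ 3 := by
      rw [← Real.exp_nat_mul, ← Real.exp_nat_mul]; norm_num
    have h5 := Real.exp_one_lt_d9
    have h6 : Real.exp 1 ^ 3 ≤ 2.7182818286 ^ 3 := by gcongr
    refine le_of_pow_le_pow_left₀ (n := 4) (by norm_num) (by norm_num) ?_
    rw [h4]
    exact h6.trans (by norm_num)
  refine h2.trans ?_
  rw [hb, Real.rpow_def_of_pos (by norm_num)]
  gcongr
  nlinarith

end Numerics

/-! ### Harnack inequality on a component of the cap. -/

section ComponentHarnack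

variable {N : ℕ} {ω : Euc N} {t R : ℝ} {G : Set (Euc N)} {w : Euc N → ℝ}

theorem reflPt_mem_of_mem_cap (hω : ‖ω‖ = 1) (hG : reflCap G ω t ⊆ G) {p : Euc N}
    (hp : p ∈ cap G ω t) : reflPt ω t p ∈ G :=
  hG (by rw [reflCap, mem_ofPred, reflPt_reflPt hω]; exact hp)

theorem dist_reflPt_self (hω : ‖ω‖ = 1) (x : Euc N) :
    dist x (reflPt ω t x) = 2 * |⟪x, ω⟫ - t| := by
  rw [dist_eq_norm, reflPt, sub_sub_cancel, norm_smul, hω, mul_one, Real.norm_eq_abs, abs_mul]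
  simp

theorem inner_le_of_mem_cap (hω : ‖ω‖ = 1) (hGb : Bornology.IsBounded G)
    (hG : reflCap G ω t ⊆ G) {p : Euc N} (hp : p ∈ cap G ω t) :
    ⟪p, ω⟫ ≤ t + diam G / 2 := by
  have h1 := dist_le_diam_of_mem hGb hp.1 (reflPt_mem_of_mem_cap hω hG hp)
  rw [dist_reflPt_self hω, abs_of_pos (sub_pos.2 hp.2)] at h1
  linarith

theorem ball_subset_symmDomain_of_mem_closure (hω : ‖ω‖ = 1) (hG : reflCap G ω t ⊆ G) {x : Euc N}
    (hxt : t ≤ ⟪x, ω⟫) (hx : x ∈ closure G) : ball x R ⊆ symmDomain G R ω t :=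
  ball_subset_symmDomain hω hG hxt (ball_subset_thickening_of_mem_closure hx)

/-- On the line a connected `G` contains the whole segment from `p` to its reflection. -/
theorem mem_thickening_of_finrank_one {ω p z : Euc 1} {t R : ℝ} {G : Set (Euc 1)} (hω : ‖ω‖ = 1)
    (hGc : IsPreconnected G) (hG : reflCap G ω t ⊆ G) (hR : 0 < R)
    (hp : p ∈ cap G ω t) (hz : |⟪z, ω⟫ - t| < ⟪p, ω⟫ - t + R) : z ∈ thickening R G := by
  have hω0 : ω ≠ 0 := fun h => by simp [h] at hω
  have hrep : ∀ y : Euc 1, ⟪y, ω⟫ • ω = y := fun y => by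
    obtain ⟨c, rfl⟩ := exists_smul_eq_of_finrank_eq_one (K := ℝ) (V := Euc 1) (by simp) hω0 y
    simp [inner_smul_left, hω]
  have himg : (fun y : Euc 1 => ⟪y, ω⟫) '' G ⊇ Icc (2 * t - ⟪p, ω⟫) ⟪p, ω⟫ :=
    (hGc.image _ (by fun_prop : Continuous fun y : Euc 1 => ⟪y, ω⟫).continuousOn).Icc_subset
      ⟨_, reflPt_mem_of_mem_cap hω hG hp, inner_reflPt hω p⟩ ⟨p, hp.1, rfl⟩
  have hpt := hp.2
  rw [abs_lt] at hz
  have hs : max (2 * t - ⟪p, ω⟫) (min ⟪z, ω⟫ ⟪p, ω⟫) ∈ Icc (2 * t - ⟪p, ω⟫) ⟪p, ω⟫ :=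
    ⟨le_max_left _ _, max_le (by linarith) (min_le_right _ _)⟩
  obtain ⟨g, hg, hgs⟩ := himg hs
  refine mem_thickening_iff.2 ⟨g, hg, ?_⟩
  simp only at hgs
  rw [← hrep z, ← hrep g, dist_eq_norm, ← sub_smul, norm_smul, hω, mul_one, hgs, Real.norm_eq_abs,
    abs_lt]
  rcases max_cases (2 * t - ⟪p, ω⟫) (min ⟪z, ω⟫ ⟪p, ω⟫) with h | h <;>
  rcases min_cases ⟪z, ω⟫ ⟪p, ω⟫ with h' | h' <;> constructor <;> linarith

/-- On the line one ball suffices: its centre is halfway between the plane and the farther point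
`p`, its radius `a/2 + R ≤ R + diam G / 4`. The upper and the lower bound each contribute a cube. -/
theorem IsOddHarmonic.planeQuot_le_of_finrank_one {ω : Euc 1} {t R : ℝ} {G : Set (Euc 1)}
    {w : Euc 1 → ℝ} (hω : ‖ω‖ = 1) (hR : 0 < R)
    (hGb : Bornology.IsBounded G) (hGc : IsPreconnected G) (hG : reflCap G ω t ⊆ G)
    (h : IsOddHarmonic ω t (symmDomain G R ω t) w) {x y : Euc 1} (hx : x ∈ cap G ω t)
    (hy : y ∈ cap G ω t) :
    planeQuot ω t w x ≤ (1 + diam G / R / 4) ^ 6 * planeQuot ω t w y := by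
  obtain ⟨p, hp, hxp, hyp⟩ : ∃ p ∈ cap G ω t, ⟪x, ω⟫ ≤ ⟪p, ω⟫ ∧ ⟪y, ω⟫ ≤ ⟪p, ω⟫ := by
    rcases le_total ⟪x, ω⟫ ⟪y, ω⟫ with h | h
    · exact ⟨y, hy, h, le_rfl⟩
    · exact ⟨x, hx, le_rfl, h⟩
  have hp0 := hp.2
  have hpd := inner_le_of_mem_cap hω hGb hG hp
  set a := ⟪p, ω⟫ - t with ha
  have ha0 : 0 < a := sub_pos.2 hp0
  set c := p - (a / 2) • ω with hc
  have hci : ⟪c, ω⟫ = t + a / 2 := by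
    rw [hc, inner_sub_left, inner_smul_left, real_inner_self_eq_norm_sq, hω]
    simp; linarith
  have hct : t < ⟪c, ω⟫ := by linarith
  set r := a / 2 + R with hr
  have hcD : ball c r ⊆ symmDomain G R ω t := ball_subset_symmDomain hω hG hct.le fun z hz =>
    mem_thickening_of_finrank_one hω hGc hG hR hp (by
      rw [mem_ball, dist_eq_norm] at hz
      have h1 : |⟪z - c, ω⟫| ≤ ‖z - c‖ * ‖ω‖ := abs_real_inner_le_norm _ _
      rw [hω, mul_one, inner_sub_left, hci, abs_le] at h1
      rw [abs_lt]
      constructor <;> linarith)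
  have hrep : ∀ y : Euc 1, ⟪y, ω⟫ • ω = y := fun y => by
    obtain ⟨c, rfl⟩ := exists_smul_eq_of_finrank_eq_one (K := ℝ) (V := Euc 1) (by simp)
      (fun h => by simp [h] at hω : ω ≠ 0) y
    simp [inner_smul_left, hω]
  have hdist : ∀ q, t < ⟪q, ω⟫ → ⟪q, ω⟫ ≤ ⟪p, ω⟫ → dist q c ≤ a / 2 := fun q h1 h2 => by
    rw [← hrep q, ← hrep c, dist_eq_norm, ← sub_smul, norm_smul, hω, mul_one, hci,
      Real.norm_eq_abs, abs_le]
    constructor <;> linarith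
  have hdx := hdist x hx.2 hxp
  have hdy := hdist y hy.2 hyp
  have hDx : ∀ q ∈ cap G ω t, 0 ≤ planeQuot ω t w q := fun q hq => h.planeQuot_nonneg
    (ball_subset_symmDomain_of_mem_closure hω hG hq.2.le (subset_closure hq.1)
      (mem_ball_self hR)) hq.2
  have hr0 : 0 < r := by positivity
  have hc0 : 0 ≤ planeQuot ω t w c := h.planeQuot_nonneg (hcD (mem_ball_self hr0)) hct
  have h1 := h.planeQuot_le hω hcD hct hx.2 (by linarith)
  have h2 := h.le_planeQuot hω hcD hct hy.2 (by linarith)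
  have h1' : planeQuot ω t w x * R ^ 3 ≤ planeQuot ω t w c * r ^ 3 := by
    refine le_trans ?_ h1
    have := hDx x hx
    gcongr; linarith
  have h2' : planeQuot ω t w c * R ^ 3 ≤ planeQuot ω t w y * r ^ 3 := by
    refine le_trans ?_ h2
    gcongr; linarith
  have h3 : r ≤ (1 + diam G / R / 4) * R := by
    have : (1 + diam G / R / 4) * R = R + diam G / 4 := by field_simp
    rw [this]; linarith
  have h4 : r ^ 6 ≤ ((1 + diam G / R / 4) * R) ^ 6 := by gcongr
  rw [mul_pow] at h4
  have hR6 : 0 < R ^ 6 := by positivity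
  refine le_of_mul_le_mul_right ?_ hR6
  calc planeQuot ω t w x * R ^ 6 = planeQuot ω t w x * R ^ 3 * R ^ 3 := by ring
    _ ≤ planeQuot ω t w c * r ^ 3 * R ^ 3 := by gcongr
    _ = planeQuot ω t w c * R ^ 3 * r ^ 3 := by ring
    _ ≤ planeQuot ω t w y * r ^ 3 * r ^ 3 := by gcongr
    _ = planeQuot ω t w y * r ^ 6 := by ring
    _ ≤ planeQuot ω t w y * ((1 + diam G / R / 4) ^ 6 * R ^ 6) := by
      have := hDx y hy
      gcongr
    _ = _ := by ring

theorem IsOddHarmonic.planeQuot_le_of_joinedIn (hω : ‖ω‖ = 1) (hR : 0 < R)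
    (hGb : Bornology.IsBounded G) (hGc : IsPreconnected G) (hG : reflCap G ω t ⊆ G)
    (h : IsOddHarmonic ω t (symmDomain G R ω t) w) {S : Set (Euc N)} (hS : S ⊆ cap G ω t)
    {x y : Euc N} (hxy : JoinedIn S x y) :
    planeQuot ω t w x ≤ 64 * harnackBase N ^ ((2 + diam G / R) ^ N) * planeQuot ω t w y := by
  rcases Nat.lt_or_ge N 2 with hN | hN
  · obtain rfl | rfl : N = 0 ∨ N = 1 := by omega
    · rw [Subsingleton.elim ω 0] at hω; simp at hω
    · have hball := ball_subset_symmDomain_of_mem_closure (R := R) hω hG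
        (hS hxy.target_mem).2.le (subset_closure (hS hxy.target_mem).1)
      have hy0 := h.planeQuot_nonneg (hball (mem_ball_self hR)) (hS hxy.target_mem).2
      refine (h.planeQuot_le_of_finrank_one hω hR hGb hGc hG (hS hxy.source_mem)
        (hS hxy.target_mem)).trans ?_
      rw [pow_one]
      gcongr
      exact one_add_div_four_pow_six_le (div_nonneg diam_nonneg hR.le)
  set d := diam G with hd
  have hd0 : 0 ≤ d := diam_nonneg
  have hX : 0 ≤ d / R := by positivity
  have hball : ∀ q ∈ cap G ω t, ball q R ⊆ symmDomain G R ω t := fun q hq =>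
    ball_subset_symmDomain_of_mem_closure hω hG hq.2.le (subset_closure hq.1)
  have hxS := hS hxy.source_mem
  have hyS := hS hxy.target_mem
  have hy0 : 0 ≤ planeQuot ω t w y := h.planeQuot_nonneg (hball y hyS (mem_ball_self hR)) hyS.2
  have hSd : ∀ p ∈ S, ∀ q ∈ S, dist p q ≤ d := fun p hp q hq =>
    dist_le_diam_of_mem hGb (hS hp).1 (hS hq).1
  have hX0 : 0 ≤ (2 + d / R) ^ N := by positivity
  have hbase : 0 ≤ harnackBase N ^ ((2 + d / R) ^ N) :=
    Real.rpow_nonneg (harnackBase_pos N).le _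
  suffices hmain : planeQuot ω t w x ≤ harnackBase N ^ ((2 + d / R) ^ N) * planeQuot ω t w y by
    refine hmain.trans ?_
    gcongr
    linarith
  -- Low dimensions use the slab packing and steps of length `R` (`s = 1/2`); from dimension five
  -- on, the cruder ball packing with steps of length `3R/2` (`s = 3/4`) suffices.
  rcases Nat.lt_or_ge N 5 with hN5 | hN5
  · have hv := add_two_div_le_volume_ball hN (Nat.le_of_lt_succ hN5)
    set v := volume.real (ball (0 : Euc N) 1) with hvdef
    have hv0 : 0 < v := ENNReal.toReal_pos (measure_ball_pos _ _ one_pos).ne' measure_ball_lt_top.ne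
    obtain ⟨k, hk, hle⟩ := exists_pow_mul_le_of_joinedIn (f := planeQuot ω t w) (ε := R)
      (A := 2 ^ (2 * (N + 2))) (K := 2 ^ N / 2 / v * (2 + d / R) ^ N) hR (by positivity)
      (fun a ha b hb hab => by
        have := h.planeQuot_le_of_dist_le hω hR (hball a (hS ha)) (hball b (hS hb)) (hS ha).2
          (hS hb).2 (s := 1 / 2) (by norm_num) (by linarith)
        rw [pow_mul]
        norm_num at this ⊢
        exact this)
      (fun T hTS hT => by
        have := card_le_of_slab hω (t := t) hR hd0 hT
          (fun p hp q hq => hSd p (hTS hp) q (hTS hq))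
          (fun p hp => ⟨(hS (hTS hp)).2.le, inner_le_of_mem_cap hω hGb hG (hS (hTS hp))⟩)
        rw [div_mul_eq_mul_div, le_div_iff₀ hv0]
        exact this) hxy
    refine hle.trans ?_
    gcongr
    refine two_pow_pow_le_harnackBase_rpow hX0 hk ?_
    push_cast
    rw [← mul_div_assoc, div_le_iff₀ hv0]
    have : (0 : ℝ) < 2 ^ N := by positivity
    nlinarith
  · obtain ⟨k, hk, hle⟩ := exists_pow_mul_le_of_joinedIn (f := planeQuot ω t w) (ε := 3 / 2 * R)
      (A := 2 ^ (4 * (N + 2))) (K := (4 / 3) ^ N * (2 + d / R) ^ N) (by positivity) (by positivity)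
      (fun a ha b hb hab => by
        have := h.planeQuot_le_of_dist_le hω hR (hball a (hS ha)) (hball b (hS hb)) (hS ha).2
          (hS hb).2 (s := 3 / 4) (by norm_num) (by linarith)
        rw [pow_mul]
        norm_num at this ⊢
        exact this)
      (fun T hTS hT => by
        have := card_le_of_dist_le (by positivity) hd0 hT
          (fun p hp q hq => hSd p (hTS hp) q (hTS hq))
        have hR34 : (0 : ℝ) < (3 / 2 * R / 2) ^ N := by positivity
        rw [← mul_pow]
        refine le_of_mul_le_mul_right (this.trans ?_) hR34
        rw [← mul_pow]
        have : 4 / 3 * (2 + d / R) * (3 / 2 * R / 2) = 2 * R + d := by field_simp; ring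
        rw [this]
        exact pow_le_pow_left₀ (by positivity) (by linarith) N) hxy
    refine hle.trans ?_
    gcongr
    refine two_pow_pow_le_harnackBase_rpow hX0 hk ?_
    push_cast
    exact four_mul_add_two_mul_le hN5

end ComponentHarnack

/-! ### Local defining functions for the boundary. -/

section DefiningFunction

variable {N : ℕ} {G : Set (Euc N)} {F : Euc N → ℝ} {p : Euc N}

/-- Near `p`, the set `G` is the sublevel set `{F < 0}` of a `C²` function `F` which vanishes at
`p` and whose derivative does not. -/
structure IsDefiningFunction (G : Set (Euc N)) (p : Euc N) (F : Euc N → ℝ) : Prop where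
  contDiffAt : ContDiffAt ℝ 2 F p
  eq_zero : F p = 0
  fderiv_ne_zero : fderiv ℝ F p ≠ 0
  mem_iff : ∀ᶠ x in 𝓝 p, x ∈ G ↔ F x < 0

theorem HasHolderBoundary.exists_isDefiningFunction {r K α H : ℝ} (hr : 0 < r)
    (h : HasHolderBoundary G r K α H) (hp : p ∈ frontier G) : ∃ F, IsDefiningFunction G p F := by
  obtain ⟨ν, hν, φ, hφ0, hφ, -, -, hmem⟩ := h p hp
  set π := (Submodule.span ℝ {ν})ᗮ.orthogonalProjectionOnto with hπ
  have hφd : ContDiffAt ℝ 2 φ 0 := hφ.contDiffAt (ball_mem_nhds 0 hr)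
  have hφp : ContDiffAt ℝ 2 (fun x : Euc N => φ (π (x - p))) p := by
    refine ContDiffAt.comp (g := φ) p ?_ (π.contDiff.contDiffAt.comp p
      (contDiff_id.sub contDiff_const).contDiffAt)
    simpa using hφd
  have hFd : ContDiffAt ℝ 2 (fun x : Euc N => ⟪x - p, ν⟫ - φ (π (x - p))) p :=
    ((contDiff_id.sub contDiff_const).inner ℝ contDiff_const).contDiffAt.sub hφp
  refine ⟨fun x => ⟪x - p, ν⟫ - φ (π (x - p)), hFd, by simp [hφ0], fun h0 => ?_, ?_⟩
  · have hπν : π ν = 0 := by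
      rw [hπ, Submodule.orthogonalProjectionOnto_eq_zero_iff, Submodule.orthogonal_orthogonal]
      exact Submodule.mem_span_singleton_self ν
    have h1 : HasDerivAt (fun s : ℝ => p + s • ν) ν 0 := by
      simpa using ((hasDerivAt_id (0 : ℝ)).smul_const ν).const_add p
    have h2 := (hFd.differentiableAt (by norm_num)).hasFDerivAt
    rw [h0] at h2
    have h3 : HasDerivAt (fun s : ℝ => ⟪(p + s • ν) - p, ν⟫ - φ (π ((p + s • ν) - p))) 0 0 :=
      HasFDerivAt.comp_hasDerivAt_of_eq (0 : ℝ) h2 h1 (by simp)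
    have h4 : (fun s : ℝ => ⟪(p + s • ν) - p, ν⟫ - φ (π ((p + s • ν) - p))) = fun s => s := by
      ext s
      simp [hπν, hφ0, inner_smul_left, hν]
    rw [h4] at h3
    exact zero_ne_one (h3.unique (hasDerivAt_id (0 : ℝ)))
  · filter_upwards [ball_mem_nhds p hr] with x hx
    rw [hmem x hx, sub_neg]

/-- Strict differentiability gives monotonicity for both points varying near `p`, as needed for a
point and its reflection. -/
theorem IsDefiningFunction.eventually_lt (h : IsDefiningFunction G p F) {v : Euc N}
    (hv : 0 < fderiv ℝ F p v) :
    ∀ᶠ q : Euc N × Euc N in 𝓝 (p, p), ∀ s > (0 : ℝ), q.1 - q.2 = s • v → F q.2 < F q.1 := by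
  have hs := (h.contDiffAt.hasStrictFDerivAt (by norm_num)).isLittleO
  have hv0 : v ≠ 0 := fun h0 => by simp [h0] at hv
  have hn : 0 < ‖v‖ := norm_pos_iff.2 hv0
  filter_upwards [hs.def (c := fderiv ℝ F p v / (2 * ‖v‖)) (by positivity)] with q hq s hs0 hqs
  rw [hqs, norm_smul, map_smul, smul_eq_mul, Real.norm_of_nonneg hs0.le, Real.norm_eq_abs, abs_le]
    at hq
  have h1 : fderiv ℝ F p v / (2 * ‖v‖) * (s * ‖v‖) = s * fderiv ℝ F p v / 2 := by field_simp
  rw [h1] at hq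
  have := mul_pos hs0 hv
  linarith [hq.1]

theorem tendsto_add_smul_nhdsGT (p v : Euc N) :
    Tendsto (fun s : ℝ => p + s • v) (𝓝[>] 0) (𝓝 p) := by
  have : Continuous fun s : ℝ => p + s • v := by fun_prop
  simpa using (this.tendsto 0).mono_left nhdsWithin_le_nhds

theorem IsDefiningFunction.eventually_mem (h : IsDefiningFunction G p F) {v : Euc N}
    (hv : fderiv ℝ F p v < 0) : ∀ᶠ s in 𝓝[>] (0 : ℝ), p + s • v ∈ G := by
  have ht := tendsto_add_smul_nhdsGT p v
  have h1 := h.eventually_lt (v := -v) (by simpa using hv)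
  filter_upwards [(tendsto_const_nhds.prodMk_nhds ht).eventually h1, ht.eventually h.mem_iff,
    eventually_mem_nhdsWithin] with s hs hs' hs0
  rw [hs', ← h.eq_zero]
  exact hs s hs0 (by simp)

theorem IsDefiningFunction.eventually_notMem_closure (h : IsDefiningFunction G p F) {v : Euc N}
    (hv : 0 < fderiv ℝ F p v) : ∀ᶠ s in 𝓝[>] (0 : ℝ), p + s • v ∉ closure G := by
  have ht := tendsto_add_smul_nhdsGT p v
  have h1 := h.eventually_lt hv
  have h2 : ∀ᶠ x in 𝓝 p, ContinuousAt F x :=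
    (h.contDiffAt.eventually (by simp)).mono fun x hx => hx.continuousAt
  filter_upwards [(ht.prodMk_nhds tendsto_const_nhds).eventually h1,
    ht.eventually (eventually_eventually_nhds.2 h.mem_iff), ht.eventually h2,
    eventually_mem_nhdsWithin] with s hs hs' hsc hs0
  have hpos : 0 < F (p + s • v) := by
    rw [← h.eq_zero]
    exact hs s hs0 (by simp)
  rw [mem_closure_iff_frequently, not_frequently]
  filter_upwards [hs', hsc.eventually (lt_mem_nhds hpos)] with y hy hy' hyG
  exact (hy.1 hyG).not_gt hy'

theorem IsDefiningFunction.exists_fderiv_eq_one (h : IsDefiningFunction G p F) :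
    ∃ n, fderiv ℝ F p n = 1 := by
  obtain ⟨v, hv⟩ : ∃ v, fderiv ℝ F p v ≠ 0 := by
    by_contra! h0
    exact h.fderiv_ne_zero (by ext v; simpa using h0 v)
  exact ⟨(fderiv ℝ F p v)⁻¹ • v, by simp [hv]⟩

theorem IsDefiningFunction.exists_fderiv_neg (h : IsDefiningFunction G p F) {ω : Euc N}
    (hω : ‖ω‖ = 1) (hF : fderiv ℝ F p ω ≤ 0) : ∃ v, fderiv ℝ F p v < 0 ∧ 0 < ⟪v, ω⟫ := by
  obtain ⟨n, hn⟩ := h.exists_fderiv_eq_one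
  set δ := (1 + |⟪n, ω⟫|)⁻¹ / 2 with hδ
  have hδ0 : 0 < δ := by positivity
  refine ⟨ω - δ • n, ?_, ?_⟩
  · rw [map_sub, map_smul, hn, smul_eq_mul]; linarith
  · rw [inner_sub_left, inner_smul_left, real_inner_self_eq_norm_sq, hω]
    have h1 : δ * (1 + |⟪n, ω⟫|) = 1 / 2 := by rw [hδ]; field_simp
    have h2 := le_abs_self ⟪n, ω⟫
    simp only [conj_trivial]
    nlinarith

/-- A boundary point has points off `closure G` arbitrarily near it. This upgrades inclusions of
open sets in `closure G` to inclusions in `G`. -/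
theorem interior_closure_of_isDefiningFunction (hG : IsOpen G)
    (hF : ∀ p ∈ frontier G, ∃ F, IsDefiningFunction G p F) : interior (closure G) = G := by
  refine subset_antisymm (fun p hp => ?_) (interior_maximal subset_closure hG)
  by_contra hpG
  obtain ⟨F, h⟩ := hF p ⟨interior_subset hp, by rwa [hG.interior_eq]⟩
  obtain ⟨n, hn⟩ := h.exists_fderiv_eq_one
  have h1 := h.eventually_notMem_closure (v := n) (by rw [hn]; exact one_pos)
  have h2 := (tendsto_add_smul_nhdsGT p n).eventually (isOpen_interior.mem_nhds hp)
  obtain ⟨s, hs, hs'⟩ := (h1.and h2).exists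
  exact hs (interior_subset hs')

/-- Tilting `ω` slightly outwards leaves `closure G`, tilting it inwards enters `G`; by
connectedness some direction in between meets the frontier, and the tilt tends to zero. -/
theorem IsDefiningFunction.mem_tangentConeAt (hG : IsOpen G) (h : IsDefiningFunction G p F) {ω : Euc N}
    (hF : fderiv ℝ F p ω = 0) : ω ∈ tangentConeAt ℝ (frontier G) p := by
  obtain ⟨n, hn⟩ := h.exists_fderiv_eq_one
  have key : ∀ k : ℕ, ∃ s τ : ℝ, 0 < s ∧ s < 1 / ((k : ℝ) + 1) ∧ |τ| ≤ 1 / ((k : ℝ) + 1) ∧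
      p + s • (ω + τ • n) ∈ frontier G := fun k => by
    set ε : ℝ := 1 / ((k : ℝ) + 1) with hε
    have hε0 : 0 < ε := by positivity
    have h1 := h.eventually_notMem_closure (v := ω + ε • n) (by simp [hF, hn, hε0])
    have h2 := h.eventually_mem (v := ω + (-ε) • n) (by simp [hF, hn, hε0])
    obtain ⟨s, ⟨hs1, hs2⟩, hs0, hsε⟩ :=
      ((h1.and h2).and (Ioo_mem_nhdsGT hε0)).exists
    have hc : Continuous fun τ : ℝ => p + s • (ω + τ • n) := by fun_prop
    obtain ⟨τ, hτ, hy⟩ : ∃ τ ∈ Icc (-ε) ε, p + s • (ω + τ • n) ∈ frontier G := by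
      by_contra! hnot
      obtain ⟨y, -, hy1, hy2⟩ := (isPreconnected_Icc (a := -ε) (b := ε)).image _ hc.continuousOn G
        (closure G)ᶜ hG isClosed_closure.isOpen_compl
        (by
          rintro _ ⟨τ, hτ, rfl⟩
          by_cases hcl : p + s • (ω + τ • n) ∈ closure G
          · by_contra hn
            refine hnot τ hτ ⟨hcl, fun hi => hn (Or.inl (interior_subset hi))⟩
          · exact Or.inr hcl)
        ⟨_, ⟨-ε, ⟨le_rfl, by linarith⟩, rfl⟩, hs2⟩ ⟨_, ⟨ε, ⟨by linarith, le_rfl⟩, rfl⟩, hs1⟩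
      exact hy2 (subset_closure hy1)
    exact ⟨s, τ, hs0, hsε, abs_le.2 hτ, hy⟩
  choose s τ hs0 hs hτ hfr using key
  have hs' : Tendsto s atTop (𝓝 0) := squeeze_zero (fun k => (hs0 k).le) (fun k => (hs k).le)
    tendsto_one_div_add_atTop_nhds_zero_nat
  have hτ' : Tendsto τ atTop (𝓝 0) :=
    squeeze_zero_norm hτ tendsto_one_div_add_atTop_nhds_zero_nat
  have hlim : Tendsto (fun k => ω + τ k • n) atTop (𝓝 ω) := by
    simpa using (hτ'.smul_const n).const_add ω
  refine mem_tangentConeAt_of_seq atTop (fun k => (s k)⁻¹) (fun k => s k • (ω + τ k • n)) ?_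
    (Eventually.of_forall hfr) ?_
  · simpa using hs'.smul hlim
  · refine hlim.congr fun k => ?_
    rw [smul_smul, inv_mul_cancel₀ (hs0 k).ne', one_smul]

end DefiningFunction

/-! ### The critical position and its critical points. -/

section MovingPlane

variable {N : ℕ} {ω : Euc N} {G : Set (Euc N)} {t : ℝ}

theorem bddAbove_inner_image (ω : Euc N) (hGb : Bornology.IsBounded G) :
    BddAbove ((fun x : Euc N => ⟪x, ω⟫) '' G) := by
  obtain ⟨B, hB⟩ := hGb.exists_norm_le
  refine ⟨B * ‖ω‖, ?_⟩
  rintro _ ⟨x, hx, rfl⟩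
  exact (real_inner_le_norm x ω).trans (by gcongr; exact hB x hx)

theorem inner_le_extent (ω : Euc N) (hGb : Bornology.IsBounded G) {x : Euc N}
    (hx : x ∈ closure G) : ⟪x, ω⟫ ≤ extent G ω := by
  refine closure_minimal (fun y hy => ?_)
    (isClosed_le (by fun_prop : Continuous fun z : Euc N => ⟪z, ω⟫) continuous_const) hx
  exact le_csSup (bddAbove_inner_image ω hGb) ⟨y, hy, rfl⟩

theorem bddBelow_planePositions (hω : ‖ω‖ = 1) (hGb : Bornology.IsBounded G) (hne : G.Nonempty) :
    BddBelow {μ : ℝ | ∀ t ∈ Ioo μ (extent G ω), reflCap G ω t ⊆ G} := by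
  obtain ⟨B, hB⟩ := hGb.exists_norm_le
  have hlow : ∀ x ∈ G, -B ≤ ⟪x, ω⟫ := fun x hx => by
    have h1 : |⟪x, ω⟫| ≤ ‖x‖ * ‖ω‖ := abs_real_inner_le_norm x ω
    rw [hω, mul_one, abs_le] at h1
    linarith [hB x hx]
  obtain ⟨x, hx⟩ := hne
  refine ⟨-B, fun μ hμ => ?_⟩
  by_contra! hlt
  have hxl := hlow x hx
  have hxe := inner_le_extent ω hGb (subset_closure hx)
  -- Reflected about this position, `x` has height `μ - B - ⟪x, ω⟫ ≤ μ < -B`, below all of `G`.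
  have h1 := hμ ((μ - B) / 2) ⟨by linarith, by linarith⟩
  have h2 := hlow _ (reflPt_mem_of_mem_cap hω h1 ⟨hx, by linarith⟩)
  rw [inner_reflPt hω] at h2
  linarith

theorem reflCap_subset_of_critPos_lt (h1 : critPos G ω < t) (h2 : t < extent G ω) :
    reflCap G ω t ⊆ G := by
  -- The set of admissible positions is nonempty: the extent itself belongs to it vacuously.
  obtain ⟨μ, hμ, hμt⟩ := exists_lt_of_csInf_lt
    ⟨extent G ω, fun _ ht => absurd (ht.1.trans ht.2) (lt_irrefl _)⟩ h1
  exact hμ t ⟨hμt, h2⟩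

theorem exists_not_reflCap_subset (hω : ‖ω‖ = 1) (hGb : Bornology.IsBounded G)
    (hne : G.Nonempty) {μ : ℝ} (hμ : μ < critPos G ω) :
    ∃ t, μ < t ∧ t < extent G ω ∧ t ≤ critPos G ω ∧ ¬ reflCap G ω t ⊆ G := by
  have := notMem_of_lt_csInf hμ (bddBelow_planePositions hω hGb hne)
  simp only [mem_ofPred, not_forall] at this
  obtain ⟨t, ht, hn⟩ := this
  exact ⟨t, ht.1, ht.2, not_lt.1 fun h => hn (reflCap_subset_of_critPos_lt h ht.2), hn⟩

/-- The limit `p` is an accumulation point of cap points whose reflections leave `G`. If it lay on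
the plane with `F` increasing along `ω`, reflection would decrease `F` near `p` and keep those
points in `G`. -/
theorem exists_limit_of_not_reflCap_subset (hω : ‖ω‖ = 1) (hG : IsOpen G)
    (hGb : Bornology.IsBounded G) {s : ℕ → ℝ} (hs : Tendsto s atTop (𝓝 t))
    (hn : ∀ k, ¬ reflCap G ω (s k) ⊆ G) :
    ∃ p ∈ closure G, t ≤ ⟪p, ω⟫ ∧ reflPt ω t p ∉ G ∧
      (⟪p, ω⟫ = t → ∀ F, IsDefiningFunction G p F → fderiv ℝ F p ω ≤ 0) := by
  have hx : ∀ k, ∃ x ∈ G, s k < ⟪x, ω⟫ ∧ reflPt ω (s k) x ∉ G := fun k => by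
    obtain ⟨z, hz, hzG⟩ := not_subset.1 (hn k)
    exact ⟨_, hz.1, hz.2, by rwa [reflPt_reflPt hω]⟩
  choose x hxG hxs hxn using hx
  obtain ⟨p, hp, φ, hφ, hlim⟩ := hGb.isCompact_closure.tendsto_subseq fun k => subset_closure (hxG k)
  have hsφ := hs.comp hφ.tendsto_atTop
  have hin : Tendsto (fun k => ⟪x (φ k), ω⟫) atTop (𝓝 ⟪p, ω⟫) := hlim.inner tendsto_const_nhds
  have hz : Tendsto (fun k => reflPt ω (s (φ k)) (x (φ k))) atTop (𝓝 (reflPt ω t p)) :=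
    hlim.sub (((hin.sub hsφ).const_mul 2).smul_const ω)
  have hpn : reflPt ω t p ∉ G :=
    hG.isClosed_compl.mem_of_tendsto hz (Eventually.of_forall fun k => hxn (φ k))
  refine ⟨p, hp, le_of_tendsto_of_tendsto' hsφ hin fun k => (hxs (φ k)).le, hpn,
    fun hpt F hF => ?_⟩
  by_contra! hpos
  rw [reflPt_eq_self hpt] at hz
  have h1 := (hlim.prodMk_nhds hz).eventually (hF.eventually_lt hpos)
  obtain ⟨k, ⟨hk1, hk2⟩, hk3⟩ :=
    ((h1.and (hlim.eventually hF.mem_iff)).and (hz.eventually hF.mem_iff)).exists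
  have hk4 := hk1 (2 * (⟪x (φ k), ω⟫ - s (φ k))) (by linarith [hxs (φ k)]) (by simp [reflPt])
  exact hxn (φ k) (hk3.2 (hk4.trans (hk2.1 (hxG (φ k)))))

theorem isOpen_cap (hG : IsOpen G) : IsOpen (cap G ω t) :=
  hG.inter (isOpen_lt continuous_const (by fun_prop : Continuous fun z : Euc N => ⟪z, ω⟫))

theorem isOpen_reflCap (hG : IsOpen G) : IsOpen (reflCap G ω t) :=
  (isOpen_cap hG).preimage continuous_reflPt

/-- Letting the plane descend to the critical position gives inclusion in `closure G`; the reflected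
cap is open and `G` is the interior of its closure. -/
theorem reflCap_critPos_subset (hω : ‖ω‖ = 1) (hG : IsOpen G) (hGb : Bornology.IsBounded G)
    (hF : ∀ p ∈ frontier G, ∃ F, IsDefiningFunction G p F) :
    reflCap G ω (critPos G ω) ⊆ G := by
  refine (interior_maximal (fun z hz => ?_) (isOpen_reflCap hG)).trans
    (interior_closure_of_isDefiningFunction hG hF).subset
  obtain ⟨hxG, hxt⟩ := hz
  set x := reflPt ω (critPos G ω) z with hx
  have hzx : z = reflPt ω (critPos G ω) x := by rw [hx, reflPt_reflPt hω]
  have hc : Continuous fun t => reflPt ω t x := by unfold reflPt; fun_prop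
  have hlim : Tendsto (fun t => reflPt ω t x) (𝓝[>] (critPos G ω)) (𝓝 z) := by
    rw [hzx]
    exact (hc.tendsto _).mono_left nhdsWithin_le_nhds
  refine mem_closure_of_tendsto hlim ?_
  filter_upwards [Ioo_mem_nhdsGT hxt] with t ht
  exact reflPt_mem_of_mem_cap hω (reflCap_subset_of_critPos_lt ht.1
    (ht.2.trans_le (inner_le_extent ω hGb (subset_closure hxG)))) ⟨hxG, ht.2⟩

/-- At the critical position of the moving plane, one of the two critical cases occurs. -/
theorem exists_isTangencyPoint_or_isOrthogonalityPoint (hω : ‖ω‖ = 1)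
    (hG : IsOpen G) (hGb : Bornology.IsBounded G)
    (hne : G.Nonempty) (hF : ∀ p ∈ frontier G, ∃ F, IsDefiningFunction G p F) :
    (∃ P, IsTangencyPoint G ω P ∧ reflPt ω (critPos G ω) P ∈ closure (maxCap G ω)) ∨
      ∃ Q, IsOrthogonalityPoint G ω Q ∧ Q ∈ closure (maxCap G ω) := by
  have hm := reflCap_critPos_subset hω hG hGb hF
  have h1 : ∀ k : ℕ, ∃ t, critPos G ω - 1 / ((k : ℝ) + 1) < t ∧ t ≤ critPos G ω ∧
      ¬ reflCap G ω t ⊆ G := fun k => by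
    have hk : (0 : ℝ) < 1 / ((k : ℝ) + 1) := by positivity
    obtain ⟨t, h1, -, h2, h3⟩ := exists_not_reflCap_subset hω hGb hne
      (μ := critPos G ω - 1 / ((k : ℝ) + 1)) (by linarith)
    exact ⟨t, h1, h2, h3⟩
  choose s hs1 hs2 hs3 using h1
  have hs : Tendsto s atTop (𝓝 (critPos G ω)) := by
    refine tendsto_of_tendsto_of_tendsto_of_le_of_le ?_ tendsto_const_nhds
      (fun k => (hs1 k).le) hs2
    simpa using (tendsto_one_div_add_atTop_nhds_zero_nat (𝕜 := ℝ)).const_sub (critPos G ω)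
  obtain ⟨p, hp, hpm, hpn, hpF⟩ := exists_limit_of_not_reflCap_subset hω hG hGb hs hs3
  rcases hpm.lt_or_eq with hlt | heq
  · left
    have hpc : p ∈ closure (maxCap G ω) := by
      have ho : IsOpen {z : Euc N | critPos G ω < ⟪z, ω⟫} :=
        isOpen_lt continuous_const (by fun_prop)
      have := ho.inter_closure ⟨hlt, hp⟩
      rwa [inter_comm] at this
    have hPc : reflPt ω (critPos G ω) p ∈ closure (reflCap G ω (critPos G ω)) :=
      map_mem_closure continuous_reflPt hpc fun y hy => by
        rw [reflCap, mem_ofPred, reflPt_reflPt hω]; exact hy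
    refine ⟨reflPt ω (critPos G ω) p, ⟨⟨closure_mono hm hPc, by rwa [hG.interior_eq]⟩, ?_, hm,
      ⟨hPc, ?_⟩⟩, by rwa [reflPt_reflPt hω]⟩
    · rw [inner_reflPt hω]; linarith
    · rw [(isOpen_reflCap hG).interior_eq]
      exact fun h => hpn (hm h)
  · right
    have hpn' : p ∉ G := by rwa [reflPt_eq_self heq.symm] at hpn
    have hpf : p ∈ frontier G := ⟨hp, by rwa [hG.interior_eq]⟩
    obtain ⟨F, hFp⟩ := hF p hpf
    have hle := hpF heq.symm F hFp
    have hin : ∀ (τ : ℝ) (v : Euc N), ⟪p + τ • v, ω⟫ = critPos G ω + τ * ⟪v, ω⟫ := fun τ v => by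
      rw [inner_add_left, inner_smul_left, ← heq]; simp
    -- Otherwise `p + τω` lies in the cap for small `τ > 0` while its reflection `p - τω` lies
    -- outside `closure G`.
    have hge : 0 ≤ fderiv ℝ F p ω := by
      by_contra! hneg
      have h2 := hFp.eventually_mem hneg
      have h3 := hFp.eventually_notMem_closure (v := -ω) (by simpa using hneg)
      obtain ⟨τ, ⟨hτ1, hτ2⟩, hτ0⟩ := ((h2.and h3).and eventually_mem_nhdsWithin).exists
      refine hτ2 (subset_closure ?_)
      have h4 := hin τ ω
      rw [real_inner_self_eq_norm_sq, hω, one_pow, mul_one] at h4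
      have h5 : p + τ • -ω = reflPt ω (critPos G ω) (p + τ • ω) := by
        rw [reflPt, h4]; module
      rw [h5]
      refine reflPt_mem_of_mem_cap hω hm ⟨hτ1, ?_⟩
      have : (0 : ℝ) < τ := hτ0
      linarith
    refine ⟨p, ⟨hpf, heq.symm, hFp.mem_tangentConeAt hG (le_antisymm hle hge)⟩, ?_⟩
    obtain ⟨v, hv1, hv2⟩ := hFp.exists_fderiv_neg hω hle
    refine mem_closure_of_tendsto (tendsto_add_smul_nhdsGT p v) ?_
    filter_upwards [hFp.eventually_mem hv1, eventually_mem_nhdsWithin] with τ hτ hτ0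
    refine ⟨hτ, ?_⟩
    rw [hin]
    have : 0 < τ * ⟪v, ω⟫ := mul_pos hτ0 hv2
    linarith

theorem exists_isCriticalComponent (hω : ‖ω‖ = 1) (hG : IsOpen G) (hGb : Bornology.IsBounded G)
    (hne : G.Nonempty) (hF : ∀ p ∈ frontier G, ∃ F, IsDefiningFunction G p F)
    {R : ℝ} (hR : 0 < R) : ∃ S, IsCriticalComponent G R ω S := by
  have key : ∀ q ∈ closure (maxCap G ω), ∃ y ∈ maxCap G ω,
      (connectedComponentIn (maxCap G ω) y ∩ ball q R).Nonempty := fun q hq => by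
    obtain ⟨y, hy, hyq⟩ := Metric.mem_closure_iff.1 hq R hR
    exact ⟨y, hy, y, mem_connectedComponentIn hy, by rwa [mem_ball, dist_comm]⟩
  rcases exists_isTangencyPoint_or_isOrthogonalityPoint hω hG hGb hne hF with
    ⟨P, hP, hPc⟩ | ⟨Q, hQ, hQc⟩
  · obtain ⟨y, hy, hyP⟩ := key _ hPc
    exact ⟨_, ⟨y, hy, rfl⟩, Or.inl ⟨P, hP, hyP⟩⟩
  · obtain ⟨y, hy, hyQ⟩ := key _ hQc
    exact ⟨_, ⟨y, hy, rfl⟩, Or.inr ⟨Q, hQ, hyQ⟩⟩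

end MovingPlane

/-! ### Difference quotients and tangential derivatives on the boundary. -/

section Seminorm

variable {N : ℕ} {Γ : Set (Euc N)} {u : Euc N → ℝ}

theorem lipSeminorm_nonneg (Γ : Set (Euc N)) (u : Euc N → ℝ) : 0 ≤ lipSeminorm Γ u := by
  refine Real.sSup_nonneg ?_
  rintro _ ⟨x, -, y, -, -, rfl⟩
  positivity

/-- A real `sSup` of an unbounded set is `0`, so boundedness of the quotients has to be checked; it
holds since a locally Lipschitz function is Lipschitz on a compact set. -/
theorem abs_sub_le_lipSeminorm_mul_dist (hΓ : IsCompact Γ) (hu : ∀ x ∈ Γ, ContDiffAt ℝ 2 u x)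
    {x y : Euc N} (hx : x ∈ Γ) (hy : y ∈ Γ) : |u x - u y| ≤ lipSeminorm Γ u * dist x y := by
  obtain ⟨K, hK⟩ := LocallyLipschitzOn.exists_lipschitzOnWith_of_compact (f := u) hΓ fun x hx => by
    obtain ⟨K, t, ht, hKt⟩ := ((hu x hx).of_le (by norm_num)).exists_lipschitzOnWith
    exact ⟨K, t, mem_nhdsWithin_of_mem_nhds ht, hKt⟩
  rcases eq_or_ne x y with rfl | hxy
  · simp
  · rw [← div_le_iff₀ (dist_pos.2 hxy)]
    refine le_csSup ⟨K, ?_⟩ ⟨x, hx, y, hy, hxy, rfl⟩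
    rintro _ ⟨a, ha, b, hb, hab, rfl⟩
    rw [div_le_iff₀ (dist_pos.2 hab)]
    exact hK.dist_le_mul a ha b hb

theorem abs_fderiv_le_lipSeminorm (hΓ : IsCompact Γ) (hu : ∀ x ∈ Γ, ContDiffAt ℝ 2 u x)
    {x v : Euc N} (hx : x ∈ Γ) (hv : v ∈ tangentConeAt ℝ Γ x) :
    |fderiv ℝ u x v| ≤ lipSeminorm Γ u * ‖v‖ := by
  obtain ⟨α, l, hl, c, d, hd, hds, hcd⟩ := exists_fun_of_mem_tangentConeAt hv
  have hdiff := ((hu x hx).differentiableAt (by norm_num)).hasFDerivAt.hasFDerivWithinAt (s := Γ)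
  have hlim := (hdiff.lim hd hds hcd).abs
  refine le_of_tendsto_of_tendsto hlim (hcd.norm.const_mul (lipSeminorm Γ u)) ?_
  filter_upwards [hds] with n hn
  have := abs_sub_le_lipSeminorm_mul_dist hΓ hu hn hx
  rw [dist_eq_norm, add_sub_cancel_left] at this
  rw [smul_eq_mul, abs_mul, norm_smul, Real.norm_eq_abs]
  calc |c n| * |u (x + d n) - u x| ≤ |c n| * (lipSeminorm Γ u * ‖d n‖) := by gcongr
    _ = _ := by ring

end Seminorm

/-! ### Bounds at critical points and conclusion. -/

section CriticalComponent

variable {N : ℕ} {G : Set (Euc N)} {R : ℝ} {u : Euc N → ℝ} {ω : Euc N}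

theorem planeQuot_reflDiff_le_of_isTangencyPoint (hω : ‖ω‖ = 1) (hG : IsOpen G)
    (hGb : Bornology.IsBounded G) (hR : 0 < R) (hm : reflCap G ω (critPos G ω) ⊆ G)
    (hud : ∀ x ∈ frontier G, ContDiffAt ℝ 2 u x)
    (hodd : IsOddHarmonic ω (critPos G ω) (symmDomain G R ω (critPos G ω)) (reflDiff G ω u))
    {P y : Euc N} (hP : IsTangencyPoint G ω P) (hy : y ∈ maxCap G ω)
    (hyP : dist y (reflPt ω (critPos G ω) P) < R) :
    planeQuot ω (critPos G ω) (reflDiff G ω u) y ≤ 4 ^ (N + 2) * (2 * lipSeminorm (frontier G) u) := by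
  set m := critPos G ω with hmdef
  set p := reflPt ω m P with hp
  have hpP : reflPt ω m p = P := reflPt_reflPt hω P
  obtain ⟨hPf, hPm, -, hPc⟩ := hP
  have hpc : p ∈ closure (maxCap G ω) :=
    map_mem_closure (s := reflCap G ω m) (f := reflPt ω m) continuous_reflPt
      (frontier_subset_closure hPc) fun z hz => hz
  have hpG : p ∈ closure G := closure_mono (fun z hz => hz.1) hpc
  have hpm : m < ⟪p, ω⟫ := by
    have h1 : m ≤ ⟪p, ω⟫ := closure_minimal (fun z hz => le_of_lt hz.2)
      (isClosed_le continuous_const (by fun_prop : Continuous fun z : Euc N => ⟪z, ω⟫)) hpc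
    refine lt_of_le_of_ne h1 fun h => hPm ?_
    rw [hp, inner_reflPt hω] at h
    linarith
  -- If `p` were in `G`, then `P` would lie in the open reflected cap and not on its frontier.
  have hpf : p ∈ frontier G := by
    refine ⟨hpG, fun hi => ?_⟩
    rw [(isOpen_reflCap hG).frontier_eq] at hPc
    exact hPc.2 ⟨interior_subset hi, hpm⟩
  have hΓ : IsCompact (frontier G) :=
    hGb.isCompact_closure.of_isClosed_subset isClosed_frontier frontier_subset_closure
  have hbound : planeQuot ω m (reflDiff G ω u) p ≤ 2 * lipSeminorm (frontier G) u := by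
    have h1 := abs_sub_le_lipSeminorm_mul_dist hΓ hud hPf hpf
    rw [dist_comm, ← hpP, dist_reflPt_self hω, abs_of_pos (sub_pos.2 hpm)] at h1
    rw [planeQuot, div_le_iff₀ (sub_pos.2 hpm), reflDiff, ← hmdef]
    linarith [le_abs_self (u (reflPt ω m p) - u p)]
  have h2 := hodd.planeQuot_le_of_dist_le hω hR
    (ball_subset_symmDomain_of_mem_closure hω hm hy.2.le (subset_closure hy.1))
    (ball_subset_symmDomain_of_mem_closure hω hm hpm.le hpG) hy.2 hpm (s := 1 / 2) (by norm_num)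
    (by linarith)
  refine h2.trans ?_
  norm_num
  exact hbound

/-- Along the normal to the plane the quotient is the difference quotient `(u(Q - τω) - u(Q + τω)) /
τ`. -/
theorem tendsto_planeQuot_reflDiff (hω : ‖ω‖ = 1) {Q : Euc N} (hud : DifferentiableAt ℝ u Q)
    (hQ : ⟪Q, ω⟫ = critPos G ω) :
    Tendsto (fun τ : ℝ => planeQuot ω (critPos G ω) (reflDiff G ω u) (Q + τ • ω)) (𝓝[>] 0)
      (𝓝 (-2 * fderiv ℝ u Q ω)) := by
  have h1 : ∀ v : Euc N, HasDerivAt (fun τ : ℝ => u (Q + τ • v)) (fderiv ℝ u Q v) 0 := fun v => by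
    have hl : HasDerivAt (fun τ : ℝ => Q + τ • v) v 0 := by
      simpa using ((hasDerivAt_id (0 : ℝ)).smul_const v).const_add Q
    exact HasFDerivAt.comp_hasDerivAt_of_eq (0 : ℝ) hud.hasFDerivAt hl (by simp)
  have h2 := ((h1 (-ω)).sub (h1 ω)).tendsto_slope_zero_right
  have h3 : fderiv ℝ u Q (-ω) - fderiv ℝ u Q ω = -2 * fderiv ℝ u Q ω := by rw [map_neg]; ring
  rw [h3] at h2
  refine h2.congr fun τ => ?_
  have h4 : ⟪Q + τ • ω, ω⟫ = critPos G ω + τ := by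
    rw [inner_add_left, inner_smul_left, real_inner_self_eq_norm_sq, hω, hQ]; simp
  have h5 : reflPt ω (critPos G ω) (Q + τ • ω) = Q + τ • -ω := by
    rw [reflPt, h4]; module
  rw [planeQuot, reflDiff, h4, h5, add_sub_cancel_left, div_eq_inv_mul]
  simp

theorem planeQuot_reflDiff_le_of_isOrthogonalityPoint (hω : ‖ω‖ = 1)
    (hGb : Bornology.IsBounded G) (hm : reflCap G ω (critPos G ω) ⊆ G)
    (hud : ∀ x ∈ frontier G, ContDiffAt ℝ 2 u x)
    (hodd : IsOddHarmonic ω (critPos G ω) (symmDomain G R ω (critPos G ω)) (reflDiff G ω u))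
    {Q y : Euc N} (hQ : IsOrthogonalityPoint G ω Q) (hy : y ∈ maxCap G ω) (hyQ : dist y Q < R) :
    planeQuot ω (critPos G ω) (reflDiff G ω u) y ≤ 4 ^ (N + 2) * (2 * lipSeminorm (frontier G) u) := by
  set m := critPos G ω with hmdef
  obtain ⟨hQf, hQm, hQt⟩ := hQ
  have hΓ : IsCompact (frontier G) :=
    hGb.isCompact_closure.of_isClosed_subset isClosed_frontier frontier_subset_closure
  have hlim := (tendsto_planeQuot_reflDiff (G := G) hω ((hud Q hQf).differentiableAt (by norm_num))
    hQm).const_mul ((4 : ℝ) ^ (N + 2))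
  have hd := abs_fderiv_le_lipSeminorm hΓ hud hQf hQt
  rw [hω, mul_one, abs_le] at hd
  suffices h : planeQuot ω m (reflDiff G ω u) y ≤ 4 ^ (N + 2) * (-2 * fderiv ℝ u Q ω) by
    exact h.trans (mul_le_mul_of_nonneg_left (by linarith [hd.1]) (by positivity))
  -- The quotient has no meaningful value at `Q` itself, so `y` is compared with `Q + τω`. Balls of
  -- radius `R - τ` about both still fit, the second inside `ball Q R`.
  refine ge_of_tendsto hlim ?_
  filter_upwards [Ioo_mem_nhdsGT (show (0 : ℝ) < (R - dist y Q) / 2 by linarith)] with τ hτ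
  have hQτ : m < ⟪Q + τ • ω, ω⟫ := by
    rw [inner_add_left, inner_smul_left, real_inner_self_eq_norm_sq, hω, hQm, hmdef]
    simpa using hτ.1
  have hdist : dist Q (Q + τ • ω) = τ := by
    rw [dist_eq_norm, sub_add_cancel_left, norm_neg, norm_smul, hω, Real.norm_of_nonneg hτ.1.le,
      mul_one]
  have hyQ0 : 0 ≤ dist y Q := dist_nonneg
  have h2 := hodd.planeQuot_le_of_dist_le hω (R := R - τ) (y := Q + τ • ω) (by linarith [hτ.2])
    ((ball_subset_ball (by linarith [hτ.1])).trans
      (ball_subset_symmDomain_of_mem_closure hω hm hy.2.le (subset_closure hy.1)))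
    ((ball_subset_ball' (by rw [dist_comm, hdist]; linarith)).trans
      (ball_subset_symmDomain_of_mem_closure hω hm hQm.ge (frontier_subset_closure hQf)))
    hy.2 hQτ (s := 1 / 2) (by norm_num) (by
      have := dist_triangle y Q (Q + τ • ω)
      rw [hdist] at this
      linarith [hτ.2])
  norm_num at h2 ⊢
  exact h2

theorem reflDiff_le_of_isCriticalComponent (hω : ‖ω‖ = 1) (hG : IsOpen G) (hGc : IsPreconnected G)
    (hGb : Bornology.IsBounded G) (hF : ∀ p ∈ frontier G, ∃ F, IsDefiningFunction G p F)
    (hR : 0 < R) (hu : IsTorsionSolution (thickening R G) u) {S : Set (Euc N)}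
    (hS : IsCriticalComponent G R ω S) {x : Euc N} (hx : x ∈ S) :
    reflDiff G ω u x ≤ diam G / 2 * (64 * harnackBase N ^ ((2 + diam G / R) ^ N) *
      (4 ^ (N + 2) * (2 * lipSeminorm (frontier G) u))) := by
  have : Nontrivial (Euc N) := ⟨ω, 0, fun h => by simp [h] at hω⟩
  set m := critPos G ω with hmdef
  have hm : reflCap G ω m ⊆ G := reflCap_critPos_subset hω hG hGb hF
  have hodd : IsOddHarmonic ω m (symmDomain G R ω m) (reflDiff G ω u) :=
    hu.isOddHarmonic hω hGb hm
  have hud : ∀ x ∈ frontier G, ContDiffAt ℝ 2 u x := fun z hz =>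
    hu.contDiffOn.contDiffAt (isOpen_thickening.mem_nhds
      (ball_subset_thickening_of_mem_closure (frontier_subset_closure hz) (mem_ball_self hR)))
  obtain ⟨⟨x₀, hx₀, rfl⟩, hcrit⟩ := hS
  set S := connectedComponentIn (maxCap G ω) x₀ with hSdef
  have hSsub : S ⊆ cap G ω m := connectedComponentIn_subset _ _
  have hpath : IsPathConnected S :=
    ((isOpen_cap hG).connectedComponentIn.isConnected_iff_isPathConnected).1
      (isConnected_connectedComponentIn_iff.2 hx₀)
  obtain ⟨y, hyS, hy⟩ : ∃ y ∈ S, planeQuot ω m (reflDiff G ω u) y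
      ≤ 4 ^ (N + 2) * (2 * lipSeminorm (frontier G) u) := by
    rcases hcrit with ⟨P, hP, y, hyS, hyP⟩ | ⟨Q, hQ, y, hyS, hyQ⟩
    · exact ⟨y, hyS, planeQuot_reflDiff_le_of_isTangencyPoint hω hG hGb hR hm hud hodd hP
        (hSsub hyS) hyP⟩
    · exact ⟨y, hyS, planeQuot_reflDiff_le_of_isOrthogonalityPoint hω hGb hm hud hodd hQ
        (hSsub hyS) hyQ⟩
  have h1 := hodd.planeQuot_le_of_joinedIn hω hR hGb hGc hm hSsub (hpath.joinedIn x hx y hyS)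
  have hx0 : 0 < ⟪x, ω⟫ - m := sub_pos.2 (hSsub hx).2
  have hxd := inner_le_of_mem_cap hω hGb hm (hSsub hx)
  have hb := Real.rpow_nonneg (harnackBase_pos N).le ((2 + diam G / R) ^ N)
  have hL := lipSeminorm_nonneg (frontier G) u
  have hd : 0 ≤ diam G := diam_nonneg
  calc reflDiff G ω u x = (⟪x, ω⟫ - m) * planeQuot ω m (reflDiff G ω u) x := by
        rw [planeQuot]; field_simp
    _ ≤ (⟪x, ω⟫ - m) * (64 * harnackBase N ^ ((2 + diam G / R) ^ N) *
        (4 ^ (N + 2) * (2 * lipSeminorm (frontier G) u))) := by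
        gcongr
        exact h1.trans (by gcongr)
    _ ≤ _ := by
        gcongr
        linarith

/-- The first maximum is at least `1` and the second at least `4d / 2^N`. -/
theorem mul_harnackBase_rpow_le_capConst (N : ℕ) {d : ℝ} (hd : 0 ≤ d) (R ρ c : ℝ) :
    d * harnackBase N ^ ((2 + d / R) ^ N) ≤ 2 ^ N * capConst N R d ρ c := by
  have hb := Real.rpow_nonneg (harnackBase_pos N).le ((2 + d / R) ^ N)
  unfold capConst
  set A := max 1 (max (2 * d / ρ) (2 * ρ * c))
  set B := max R (d / (2 : ℝ) ^ ((N : ℤ) - 2)) with hB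
  have hA : 1 ≤ A := le_max_left _ _
  have h2N : (0 : ℝ) < 2 ^ N := by positivity
  have hdB : 4 * d ≤ 2 ^ N * B := by
    have h1 : d / (2 : ℝ) ^ ((N : ℤ) - 2) ≤ B := le_max_right _ _
    rw [zpow_sub₀ two_ne_zero, zpow_natCast] at h1
    have h2 : (2 : ℝ) ^ N * (d / (2 ^ N / 2 ^ (2 : ℤ))) = 4 * d := by
      field_simp; norm_num
    rw [← h2]
    gcongr
  have hB0 : 0 ≤ 2 ^ N * B := by linarith
  calc d * harnackBase N ^ ((2 + d / R) ^ N)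
      ≤ A * (2 ^ N * B) * harnackBase N ^ ((2 + d / R) ^ N) := by
        gcongr
        nlinarith
    _ = _ := by ring

end CriticalComponent

end MovingPlanes

end

theorem theorem3p3 (N : ℕ) :
    -- `M` depends on `N` only; `C''` depends on `ρ`, on the `C²` regularity `(r, K)` (and on `N`)
    ∃ M : ℝ, 1 ≤ M ∧ ∃ C'' : ℝ → ℝ → ℝ → ℝ, (∀ ρ r K, 0 < C'' ρ r K) ∧
      ∀ (G : Set (MovingPlanes.Euc N)) (r K α H R : ℝ)
        (u : MovingPlanes.Euc N → ℝ) (ω : MovingPlanes.Euc N),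
        IsOpen G → IsConnected G → Bornology.IsBounded G →
        0 < α → α ≤ 1 → 0 < r → MovingPlanes.HasHolderBoundary G r K α H →
        0 < R → MovingPlanes.IsTorsionSolution (G + Metric.ball 0 R) u →
        ‖ω‖ = 1 →
        (∃ S, MovingPlanes.IsCriticalComponent G R ω S) ∧
        ∀ S, MovingPlanes.IsCriticalComponent G R ω S →
          ∀ x ∈ S, MovingPlanes.reflDiff G ω u x ≤
            M * MovingPlanes.capConst N R (Metric.diam G)
                (MovingPlanes.interiorBallRadius G)
                (C'' (MovingPlanes.interiorBallRadius G) r K) *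
              MovingPlanes.lipSeminorm (frontier G) u := by
  -- Here `64` is the factor in the component Harnack inequality, `4 ^ (N + 2)` the cost of the step
  -- to the critical point, and `2 ^ N` the loss against `capConst`. As the maximum containing `C''`
  -- enters only through being at least `1`, the constant function `1` serves.
  refine ⟨64 * 4 ^ (N + 2) * 2 ^ N, ?_, fun _ _ _ => 1, fun _ _ _ => one_pos,
    fun G r K α H R u ω hG hGc hGb _ _ hr hbd hR hu hω => ?_⟩
  · have h1 : (1 : ℝ) ≤ 4 ^ (N + 2) := one_le_pow₀ (by norm_num)
    have h2 : (1 : ℝ) ≤ 2 ^ N := one_le_pow₀ (by norm_num)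
    nlinarith
  rw [add_ball_zero] at hu
  have hF : ∀ p ∈ frontier G, ∃ F, MovingPlanes.IsDefiningFunction G p F :=
    fun p hp => hbd.exists_isDefiningFunction hr hp
  refine ⟨MovingPlanes.exists_isCriticalComponent hω hG hGb hGc.nonempty hF hR,
    fun S hS x hx => ?_⟩
  have h1 := MovingPlanes.reflDiff_le_of_isCriticalComponent hω hG hGc.isPreconnected hGb hF hR
    hu hS hx
  have h2 := MovingPlanes.mul_harnackBase_rpow_le_capConst N (Metric.diam_nonneg (s := G)) R
    (MovingPlanes.interiorBallRadius G) 1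
  have hL := MovingPlanes.lipSeminorm_nonneg (frontier G) u
  refine h1.trans ?_
  calc Metric.diam G / 2 * (64 * MovingPlanes.harnackBase N ^ ((2 + Metric.diam G / R) ^ N) *
        (4 ^ (N + 2) * (2 * MovingPlanes.lipSeminorm (frontier G) u)))
      = 64 * 4 ^ (N + 2) * (Metric.diam G *
        MovingPlanes.harnackBase N ^ ((2 + Metric.diam G / R) ^ N)) *
        MovingPlanes.lipSeminorm (frontier G) u := by ring
    _ ≤ 64 * 4 ^ (N + 2) * (2 ^ N * MovingPlanes.capConst N R (Metric.diam G)
        (MovingPlanes.interiorBallRadius G) 1) * MovingPlanes.lipSeminorm (frontier G) u := by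
      gcongr
    _ = _ := by ring
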